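/- Let $p\in(0,3/4]$ and $q\in(0,1]$. Let $(X_n)_{n\ge1}$ be the steps of the elephant random walk with memory parameter $p$ and first-step parameter $q$: $\mathbf P(X_1=1)=q$, $\mathbf P(X_1=-1)=1-q$, and for every $n\ge1$, $X_{n+1}=\alpha_{n+1}X_{\beta_{n+1}}$, where $\alpha_{n+1}$, $\beta_{n+1}$ and $(X_1,\dots,X_n)$ are independent, $\mathbf P(\alpha_{n+1}=1)=p$, $\mathbf P(\alpha_{n+1}=-1)=1-p$, and $\beta_{n+1}$ is uniformly distributed on $\{1,\dots,n\}$. Put $T_n=\sum_{i=1}^nX_i$, $$a_n=\frac{\Gamma(n)\,\Gamma(2p)}{\Gamma(n+2p-1)}\ \ (\text{so } a_1=1),\qquad v_n=\sum_{i=1}^na_i^2,$$ and, for a real random variable $Y$, $\mathbf K(Y)=\sup_{u\in\mathbb R}|\mathbf P(Y\le u)-\Phi(u)|$, where $\Phi$ is the standard normal distribution function. Then there is a constant $C>0$ depending only on $p$ and $q$ such that for all $n\ge1$, $$\mathbf K\!\left(\frac{a_nT_n-(2q-1)}{\sqrt{v_n}}\right)\le C\left(\frac1{\sqrt n}+\frac1{v_n}\right).$$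 Moreover, for all $n\ge1$, the left-hand side is at most $C/\sqrt n$ if $p\le5/8$, and at most $C/v_n$ if $p>5/8$. -/

import Mathlib

open MeasureTheory ProbabilityTheory

/-- `IsElephantWalk μ p q X α β`: on the probability space `(Ω, μ)`, the sequence `X 1, X 2, …` is
the sequence of steps of the elephant random walk with memory parameter `p` and first-step
parameter `q`. The variable `β (n + 1)` is the time in `{1, …, n}` that the elephant remembers at
time `n + 1`, and the sign `α (n + 1)` says whether the remembered step is repeated or reversed.
(The values `X 0`, `α 0`, `α 1`, `β 0`, `β 1` play no role.) -/
structure IsElephantWalk {Ω : Type*} [MeasurableSpace Ω] (μ : Measure Ω) (p q : ℝ)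
    (X α : ℕ → Ω → ℝ) (β : ℕ → Ω → ℕ) : Prop where
  measurable_step : ∀ n, Measurable (X n)
  measurable_sign : ∀ n, Measurable (α n)
  measurable_memory : ∀ n, Measurable (β n)
  /-- The first step is `1` with probability `q` and `-1` with probability `1 - q`. -/
  first_step_pos : μ.real {ω | X 1 ω = 1} = q
  first_step_neg : μ.real {ω | X 1 ω = -1} = 1 - q
  /-- The sign is `1` with probability `p` and `-1` with probability `1 - p`. -/
  sign_pos : ∀ n, 1 ≤ n → μ.real {ω | α (n + 1) ω = 1} = p
  sign_neg : ∀ n, 1 ≤ n → μ.real {ω | α (n + 1) ω = -1} = 1 - p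
  /-- The remembered time is uniformly distributed on `{1, …, n}`. -/
  memory_uniform : ∀ n, 1 ≤ n → ∀ k ∈ Finset.Icc 1 n, μ.real {ω | β (n + 1) ω = k} = 1 / (n : ℝ)
  /-- The sign, the remembered time and the past steps `(X 1, …, X n)` are independent. -/
  indep_sign_memory : ∀ n, 1 ≤ n → IndepFun (α (n + 1)) (β (n + 1)) μ
  indep_past : ∀ n, 1 ≤ n →
    IndepFun (fun ω => (α (n + 1) ω, β (n + 1) ω)) (fun ω (i : Finset.Icc 1 n) => X i ω) μ
  /-- The dynamics of the walk. -/
  step_succ : ∀ n, 1 ≤ n → ∀ᵐ ω ∂μ, X (n + 1) ω = α (n + 1) ω * X (β (n + 1) ω) ω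

/-- The position `T_n = X_1 + ⋯ + X_n` at time `n`. -/
def elephantPosition {Ω : Type*} (X : ℕ → Ω → ℝ) (n : ℕ) (ω : Ω) : ℝ :=
  ∑ i ∈ Finset.Icc 1 n, X i ω

/-- The normalizing sequence `a_n = Γ(n) Γ(2p) / Γ(n + 2p - 1)`, used for `n ≥ 1` and `p > 0`. -/
noncomputable def elephantA (p : ℝ) (n : ℕ) : ℝ :=
  Real.Gamma n * Real.Gamma (2 * p) / Real.Gamma (n + 2 * p - 1)

/-- The formula agrees with the convention `a_1 = 1`. -/
theorem elephantA_one (p : ℝ) (hp : 0 < p) : elephantA p 1 = 1 := by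
  have h : Real.Gamma (2 * p) ≠ 0 := (Real.Gamma_pos_of_pos (by linarith)).ne'
  have e : ((1 : ℕ) : ℝ) + 2 * p - 1 = 2 * p := by push_cast; ring
  rw [elephantA, e, Nat.cast_one, Real.Gamma_one, one_mul, div_self h]

/-- `v_n = a_1 ^ 2 + ⋯ + a_n ^ 2`. -/
noncomputable def elephantV (p : ℝ) (n : ℕ) : ℝ :=
  ∑ i ∈ Finset.Icc 1 n, elephantA p i ^ 2

/-- The Kolmogorov distance `sup_u |P(Y ≤ u) - Φ(u)|` between the law of `Y` and the standard normal
distribution. (For a probability measure the supremum is over a set bounded by `1`.) -/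
noncomputable def kolmogorovDist {Ω : Type*} [MeasurableSpace Ω] (μ : Measure Ω) (Y : Ω → ℝ) : ℝ :=
  ⨆ u : ℝ, |μ.real {ω | Y ω ≤ u} - cdf (gaussianReal 0 1) u|

/-!
The process `a_n T_n - (2 q - 1)` is a martingale whose increments are weighted signs centred at
their conditional means. By Esseen's smoothing inequality it suffices to compare characteristic
functions on an interval around `0`. A sign `Y` with conditional mean `m` given the past satisfies
`E[exp (i τ (Y - m)) | past] = cos τ` up to errors of order `τ² m²` and `|τ|³ |m|`, so the
characteristic function of the martingale nearly satisfies the recursion of a product of cosines.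

For the walk, `m` is a multiple of `T_k / k`, and `a_k² E[T_k²]` is of the order of `v_k`. Hence
`a_{k+1}² E[m²]` is of the order of `v_k / k²`. If `v_k ≤ L √k` for `k ≤ n`, these sum to `O(L)`,
which costs `L / v_n` in the Kolmogorov distance; `L` can be taken constant for `p ≥ 5/8` and of the
order of `v_n / √n` for `p ≤ 5/8`. The other errors only matter at late times, where
`v_k ≥ v_n / 2`: the contraction accumulated over these times damps the earlier ones.
-/

open Filter Topology

noncomputable section

section FejerKernel

/-- The Fejér kernel `(sin (u / 2) / (u / 2)) ^ 2`, the smoothing kernel of Esseen's inequality. -/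
def fejerKernel (u : ℝ) : ℝ := Real.sinc (u / 2) ^ 2

/-- The triangular distribution, with density `max (1 - |t|) 0`, as the law of the sum of two
independent uniform variables on `(-1 / 2, 1 / 2]`. Its characteristic function is the Fejér
kernel. -/
def triangularMeasure : Measure ℝ :=
  volume.restrict (Set.Ioc (-(1 / 2)) (1 / 2)) ∗ volume.restrict (Set.Ioc (-(1 / 2)) (1 / 2))

theorem continuous_fejerKernel : Continuous fejerKernel := by
  have := Real.continuous_sinc
  unfold fejerKernel
  fun_prop

theorem fejerKernel_nonneg (u : ℝ) : 0 ≤ fejerKernel u := sq_nonneg _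

theorem fejerKernel_le_inv_one_add_sq (u : ℝ) : fejerKernel u ≤ 5 * (1 + u ^ 2)⁻¹ := by
  have near : fejerKernel u ≤ 1 := (sq_le_one_iff_abs_le_one _).2 (Real.abs_sinc_le_one _)
  have far : fejerKernel u * u ^ 2 ≤ 4 := by
    rcases eq_or_ne u 0 with rfl | hu
    · norm_num
    · have : fejerKernel u * u ^ 2 = 4 * Real.sin (u / 2) ^ 2 := by
        rw [fejerKernel, Real.sinc_of_ne_zero (by positivity)]
        field
      linarith [Real.sin_sq_le_one (u / 2)]
  rw [← div_eq_mul_inv, le_div_iff₀ (by positivity)]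
  linarith

theorem integrable_fejerKernel : Integrable fejerKernel := by
  refine (integrable_inv_one_add_sq.const_mul 5).mono'
    continuous_fejerKernel.aestronglyMeasurable (ae_of_all _ fun u => ?_)
  rw [Real.norm_of_nonneg (fejerKernel_nonneg u)]
  exact fejerKernel_le_inv_one_add_sq u

theorem integral_fejerKernel_pos : 0 < ∫ u, fejerKernel u :=
  (integral_pos_iff_support_of_nonneg fejerKernel_nonneg integrable_fejerKernel).2 <|
    continuous_fejerKernel.isOpen_support.measure_pos volume ⟨0, by simp [fejerKernel]⟩

instance : IsProbabilityMeasure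
    (volume.restrict (Set.Ioc (-(1 / 2) : ℝ) (1 / 2))) :=
  ⟨by rw [Measure.restrict_apply_univ, Real.volume_Ioc]; norm_num⟩

instance : IsProbabilityMeasure triangularMeasure := by
  unfold triangularMeasure; infer_instance

theorem charFun_restrict_Ioc_half (t : ℝ) :
    charFun (volume.restrict (Set.Ioc (-(1 / 2)) (1 / 2))) t = Real.sinc (t / 2) := by
  rw [charFun_apply_real, ← intervalIntegral.integral_of_le (by norm_num)]
  rcases eq_or_ne t 0 with rfl | ht
  · norm_num
  · have h := intervalIntegral.integral_comp_mul_left (a := -(1 / 2)) (b := 1 / 2)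
      (fun z : ℝ => Complex.exp (z * Complex.I)) ht
    rw [show t * -(1 / 2) = -(t / 2) by ring, show t * (1 / 2) = t / 2 by ring,
      integral_exp_mul_I_eq_sinc, Complex.real_smul] at h
    push_cast at h
    rw [h]
    field [Complex.ofReal_ne_zero.2 ht]

theorem charFun_triangularMeasure (u : ℝ) : charFun triangularMeasure u = fejerKernel u := by
  rw [triangularMeasure, charFun_conv, charFun_restrict_Ioc_half, fejerKernel, ← sq,
    Complex.ofReal_pow]

theorem triangularMeasure_le_restrict :
    triangularMeasure ≤ volume.restrict (Set.Ioc (-1) 1) := by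
  refine Measure.le_iff.2 fun s hs => ?_
  rw [triangularMeasure, Measure.conv, Measure.map_apply (by fun_prop) hs,
    Measure.prod_apply (measurable_add hs), Measure.restrict_apply hs]
  have key : ∀ x ∈ Set.Ioc (-(1 / 2) : ℝ) (1 / 2), volume.restrict (Set.Ioc (-(1 / 2)) (1 / 2))
      (Prod.mk x ⁻¹' ((fun y : ℝ × ℝ => y.1 + y.2) ⁻¹' s)) ≤ volume (s ∩ Set.Ioc (-1) 1) := by
    intro x hx
    rw [← measure_preimage_add volume x (s ∩ Set.Ioc (-1) 1),
      Measure.restrict_apply (measurable_prodMk_left (measurable_add hs))]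
    refine measure_mono fun y hy => ⟨hy.1, ?_, ?_⟩
    · linarith [hx.1, hy.2.1]
    · linarith [hx.2, hy.2.2]
  calc _ ≤ ∫⁻ _ in Set.Ioc (-(1 / 2) : ℝ) (1 / 2), volume (s ∩ Set.Ioc (-1) 1) :=
        setLIntegral_mono measurable_const key
    _ = volume (s ∩ Set.Ioc (-1) 1) := by
        rw [lintegral_const, measure_univ, mul_one]

theorem integral_triangularMeasure_le {h : ℝ → ℝ} (hh : IntervalIntegrable h volume (-1) 1)
    (h0 : ∀ t, 0 ≤ h t) : ∫ t, h t ∂triangularMeasure ≤ ∫ t in (-1 : ℝ)..1, h t := by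
  rw [intervalIntegral.integral_of_le (by norm_num)]
  exact integral_mono_measure triangularMeasure_le_restrict (ae_of_all _ h0) hh.1

end FejerKernel

section Smoothing

variable (μ ρ : Measure ℝ) [IsFiniteMeasure μ] [IsFiniteMeasure ρ]

theorem abs_mul_norm_integral_exp_neg_mul_I_le (t a b : ℝ) :
    |t| * ‖∫ z in a..b, Complex.exp (-(t * z * Complex.I))‖ ≤ 2 := by
  rcases eq_or_ne t 0 with rfl | ht
  · simp
  have hc : -(t * Complex.I) ≠ 0 := by simp [ht]
  have unit : ∀ z : ℝ, ‖Complex.exp (-(t * Complex.I) * z)‖ = 1 := fun z => by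
    rw [← Complex.norm_exp_ofReal_mul_I (-(t * z))]
    push_cast
    ring_nf
  calc |t| * ‖∫ z in a..b, Complex.exp (-(t * z * Complex.I))‖
      = |t| * ‖∫ z in a..b, Complex.exp (-(t * Complex.I) * z)‖ := by
        congr! 5; ring
    _ = ‖Complex.exp (-(t * Complex.I) * b) - Complex.exp (-(t * Complex.I) * a)‖ := by
        rw [integral_exp_mul_complex hc, norm_div]
        simp [mul_div_cancel₀, ht]
    _ ≤ 2 := (norm_sub_le _ _).trans_eq (by rw [unit, unit]; norm_num)

theorem integral_charFun_sub (z : ℝ) :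
    ∫ y, charFun ρ (y - z) ∂μ = ∫ t, Complex.exp (-(t * z * Complex.I)) * charFun μ t ∂ρ := by
  simp_rw [charFun_apply_real]
  rw [integral_integral_swap]
  · refine integral_congr_ae (ae_of_all _ fun t => ?_)
    simp only
    rw [← integral_const_mul]
    refine integral_congr_ae (ae_of_all _ fun y => ?_)
    simp only
    rw [← Complex.exp_add]
    push_cast
    ring_nf
  · refine Integrable.of_bound (C := 1) (Continuous.aestronglyMeasurable ?_)
      (ae_of_all _ fun x => ?_)
    · unfold Function.uncurry
      fun_prop
    · simp only [Function.uncurry]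
      rw [← Complex.ofReal_mul, Complex.norm_exp_ofReal_mul_I]

theorem integral_intervalIntegral_charFun_sub (a b : ℝ) :
    ∫ y, (∫ z in a..b, charFun ρ (y - z)) ∂μ =
      ∫ t, (∫ z in a..b, Complex.exp (-(t * z * Complex.I))) * charFun μ t ∂ρ := by
  have : IsFiniteMeasure (volume.restrict (Set.uIoc a b)) :=
    isFiniteMeasure_restrict.2 (by simp [Set.uIoc])
  rw [← intervalIntegral_integral_swap]
  · simp_rw [integral_charFun_sub, ← intervalIntegral.integral_mul_const]
    refine intervalIntegral_integral_swap (Integrable.of_bound (C := μ.real Set.univ)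
      (Measurable.aestronglyMeasurable ?_) (ae_of_all _ fun x => ?_))
    · have := measurable_charFun (μ := μ)
      unfold Function.uncurry
      fun_prop
    · have : Complex.exp (-(x.2 * x.1 * Complex.I)) =
          Complex.exp ((-(x.2 * x.1) : ℝ) * Complex.I) := by
        push_cast; ring_nf
      rw [Function.uncurry, norm_mul, this, Complex.norm_exp_ofReal_mul_I, one_mul]
      exact norm_charFun_le _
  · have := measurable_charFun (μ := ρ)
    refine Integrable.of_bound (C := ρ.real Set.univ)
      (Measurable.aestronglyMeasurable ?_) (ae_of_all _ fun x => norm_charFun_le _)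
    unfold Function.uncurry
    fun_prop

theorem integrable_intervalIntegral_exp_mul_charFun (a b : ℝ) :
    Integrable (fun t : ℝ => (∫ z in a..b, Complex.exp (-(t * z * Complex.I))) * charFun μ t)
      ρ := by
  have hQ : Continuous fun t : ℝ => ∫ z in a..b, Complex.exp (-(t * z * Complex.I)) := by
    fun_prop
  have hμ : Integrable (charFun μ) ρ :=
    .of_bound measurable_charFun.aestronglyMeasurable (μ.real Set.univ)
      (ae_of_all _ norm_charFun_le)
  refine hμ.bdd_mul (c := |b - a|) hQ.aestronglyMeasurable (ae_of_all _ fun t => ?_)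
  refine (intervalIntegral.norm_integral_le_of_norm_le_const (C := 1) fun z _ => ?_).trans_eq
    (one_mul _)
  rw [show -(t * z * Complex.I) = (-(t * z) : ℝ) * Complex.I by push_cast; ring,
    Complex.norm_exp_ofReal_mul_I]

end Smoothing

section CdfConvolution

variable (μ ν : Measure ℝ) {K : ℝ → ℝ}

theorem integrable_mul_cdf_add (hK : Integrable K) (b : ℝ) :
    Integrable fun w => K w * cdf μ (b + w) :=
  hK.mul_bdd ((monotone_cdf μ).measurable.comp (measurable_const_add b)).aestronglyMeasurable
    (ae_of_all _ fun w => by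
      rw [Real.norm_of_nonneg (cdf_nonneg _ _)]
      exact cdf_le_one _ _)

theorem integrable_mul_cdf_add_sub (hK : Integrable K) (b : ℝ) :
    Integrable fun w => K w * (cdf μ (b + w) - cdf ν (b + w)) := by
  simp_rw [mul_sub]
  exact (integrable_mul_cdf_add μ hK b).sub (integrable_mul_cdf_add ν hK b)

theorem tendsto_integral_mul_cdf_add_atBot (hK : Integrable K) :
    Tendsto (fun a => ∫ w, K w * cdf μ (a + w)) atBot (𝓝 0) := by
  rw [← integral_zero ℝ ℝ]
  refine tendsto_integral_filter_of_dominated_convergence (fun w => ‖K w‖)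
    (Eventually.of_forall fun a => (integrable_mul_cdf_add μ hK a).aestronglyMeasurable)
    (Eventually.of_forall fun a => ae_of_all _ fun w => ?_) hK.norm (ae_of_all _ fun w => ?_)
  · rw [norm_mul, Real.norm_of_nonneg (cdf_nonneg _ _)]
    exact mul_le_of_le_one_right (norm_nonneg _) (cdf_le_one _ _)
  · simpa using ((tendsto_cdf_atBot μ).comp
      (tendsto_atBot_add_const_right _ w tendsto_id)).const_mul (K w)

variable [IsProbabilityMeasure μ] [IsProbabilityMeasure ν]

theorem measureReal_Ioc_eq_cdf_sub {a b : ℝ} (hab : a ≤ b) :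
    μ.real (Set.Ioc a b) = cdf μ b - cdf μ a := by
  rw [measureReal_def, ← measure_cdf μ, StieltjesFunction.measure_Ioc, measure_cdf,
    ENNReal.toReal_ofReal (sub_nonneg.2 (monotone_cdf μ hab))]

theorem integral_intervalIntegral_sub_eq_integral_mul_cdf (hK : Integrable K) {a b : ℝ}
    (hab : a ≤ b) :
    ∫ y, (∫ z in a..b, K (y - z)) ∂μ = ∫ w, K w * (cdf μ (b + w) - cdf μ (a + w)) := by
  have shift : ∀ y, ∫ z in a..b, K (y - z) =
      ∫ w, (Set.Ioc (a + w) (b + w)).indicator (fun _ => K w) y := fun y => by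
    rw [intervalIntegral.integral_comp_sub_left, intervalIntegral.integral_of_le (by linarith),
      ← integral_Ico_eq_integral_Ioc, ← integral_indicator measurableSet_Ico]
    congr! 2 with _
    simp only [Set.indicator_apply, Set.mem_Ico, Set.mem_Ioc, sub_le_iff_le_add, lt_sub_iff_add_lt,
      add_comm, and_comm]
  simp_rw [shift]
  rw [integral_integral_swap]
  · congr! 2 with w
    rw [integral_indicator measurableSet_Ioc, setIntegral_const, smul_eq_mul, mul_comm,
      measureReal_Ioc_eq_cdf_sub μ (by linarith)]
  · have hS : MeasurableSet {x : ℝ × ℝ | x.1 ∈ Set.Ioc (a + x.2) (b + x.2)} :=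
      .inter (measurableSet_lt (f := fun x : ℝ × ℝ => a + x.2) (by fun_prop) measurable_fst)
        (measurableSet_le (g := fun x : ℝ × ℝ => b + x.2) measurable_fst (by fun_prop))
    exact (hK.comp_snd μ).indicator hS

theorem abs_integral_intervalIntegral_fejerKernel_sub_le {h : ℝ → ℝ}
    (hh : IntervalIntegrable h volume (-1) 1) (h0 : ∀ t, 0 ≤ h t)
    (hle : ∀ t, |t| ≤ 1 → ‖charFun μ t - charFun ν t‖ ≤ |t| * h t) (a b : ℝ) :
    |∫ y, (∫ z in a..b, fejerKernel (y - z)) ∂μ - ∫ y, (∫ z in a..b, fejerKernel (y - z)) ∂ν| ≤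
      2 * ∫ t in (-1 : ℝ)..1, h t := by
  have toCharFun : ∀ (κ : Measure ℝ) [IsProbabilityMeasure κ],
      ((∫ y, (∫ z in a..b, fejerKernel (y - z)) ∂κ : ℝ) : ℂ) =
        ∫ t, (∫ z in a..b, Complex.exp (-(t * z * Complex.I))) * charFun κ t ∂triangularMeasure :=
    fun κ _ => by
      rw [← integral_intervalIntegral_charFun_sub, ← integral_complex_ofReal]
      simp_rw [← intervalIntegral.integral_ofReal, charFun_triangularMeasure]
  rw [← Real.norm_eq_abs, ← Complex.norm_real, Complex.ofReal_sub, toCharFun μ, toCharFun ν,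
    ← integral_sub (integrable_intervalIntegral_exp_mul_charFun μ _ a b)
      (integrable_intervalIntegral_exp_mul_charFun ν _ a b)]
  calc _ ≤ ∫ t, 2 * h t ∂triangularMeasure := by
        refine norm_integral_le_of_norm_le ((Integrable.mono_measure hh.1
          triangularMeasure_le_restrict).const_mul 2) ?_
        filter_upwards [ae_mono triangularMeasure_le_restrict <|
          ae_restrict_mem measurableSet_Ioc] with t ht
        rw [← mul_sub, norm_mul]
        calc _ ≤ ‖∫ z in a..b, Complex.exp (-(t * z * Complex.I))‖ * (|t| * h t) := by
              gcongr
              exact hle t (abs_le.2 ⟨ht.1.le, ht.2⟩)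
          _ = |t| * ‖∫ z in a..b, Complex.exp (-(t * z * Complex.I))‖ * h t := by ring
          _ ≤ 2 * h t := by
              gcongr
              · exact h0 t
              · exact abs_mul_norm_integral_exp_neg_mul_I_le t a b
    _ ≤ _ := by
        rw [integral_const_mul]
        gcongr
        exact integral_triangularMeasure_le hh h0

theorem abs_integral_fejerKernel_mul_cdf_sub_le {h : ℝ → ℝ}
    (hh : IntervalIntegrable h volume (-1) 1) (h0 : ∀ t, 0 ≤ h t)
    (hle : ∀ t, |t| ≤ 1 → ‖charFun μ t - charFun ν t‖ ≤ |t| * h t) (b : ℝ) :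
    |∫ w, fejerKernel w * (cdf μ (b + w) - cdf ν (b + w))| ≤ 2 * ∫ t in (-1 : ℝ)..1, h t := by
  have hμ := integrable_mul_cdf_add μ integrable_fejerKernel
  have hν := integrable_mul_cdf_add ν integrable_fejerKernel
  have bound : ∀ a ≤ b, |((∫ w, fejerKernel w * cdf μ (b + w)) - ∫ w, fejerKernel w * cdf μ (a + w))
      - ((∫ w, fejerKernel w * cdf ν (b + w)) - ∫ w, fejerKernel w * cdf ν (a + w))|
      ≤ 2 * ∫ t in (-1 : ℝ)..1, h t := fun a hab => by
    have := abs_integral_intervalIntegral_fejerKernel_sub_le μ ν hh h0 hle a b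
    simpa only [integral_intervalIntegral_sub_eq_integral_mul_cdf _ integrable_fejerKernel hab,
      mul_sub, integral_sub (hμ b) (hμ a), integral_sub (hν b) (hν a)] using this
  have lim := ((tendsto_integral_mul_cdf_add_atBot μ integrable_fejerKernel).const_sub
    (∫ w, fejerKernel w * cdf μ (b + w))).sub
    ((tendsto_integral_mul_cdf_add_atBot ν integrable_fejerKernel).const_sub
    (∫ w, fejerKernel w * cdf ν (b + w)))
  simp_rw [mul_sub]
  rw [integral_sub (hμ b) (hν b)]
  simpa only [sub_zero] using le_of_tendsto lim.abs ((eventually_le_atBot b).mono bound)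

end CdfConvolution

section Esseen

theorem exists_setIntegral_Ioc_ge {K : ℝ → ℝ} (hK : Integrable K) {c : ℝ} (hc : c < ∫ u, K u) :
    ∃ r : ℝ, 0 < r ∧ c ≤ ∫ u in Set.Ioc (-r) r, K u := by
  have lim : Tendsto (fun r : ℝ => ∫ u in (-r)..r, K u) atTop (𝓝 (∫ u, K u)) :=
    intervalIntegral_tendsto_integral hK tendsto_neg_atTop_atBot tendsto_id
  obtain ⟨r, hcr, hr⟩ := ((lim.eventually_const_lt hc).and (eventually_gt_atTop 0)).exists
  refine ⟨r, hr, ?_⟩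
  rw [← intervalIntegral.integral_of_le (by linarith)]
  exact hcr.le

theorem mul_integral_le_integral_mul_add {K f : ℝ → ℝ} (hK : Integrable K) (hK0 : ∀ u, 0 ≤ K u)
    (hKf : Integrable fun u => K u * f u) {s : Set ℝ} (hs : MeasurableSet s) {η D : ℝ}
    (hmass : 3 / 4 * ∫ u, K u ≤ ∫ u in s, K u) (hD : ∀ u, -D ≤ f u) (hη : ∀ u ∈ s, η ≤ f u) :
    3 / 4 * η * ∫ u, K u ≤ (∫ u, K u * f u) + D / 4 * ∫ u, K u := by
  rcases le_total η (-D) with hηD | hηD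
  · have : ∫ u, K u * -D ≤ ∫ u, K u * f u := integral_mono (hK.mul_const _) hKf fun u =>
      mul_le_mul_of_nonneg_left (hD u) (hK0 u)
    rw [integral_mul_const] at this
    nlinarith [integral_nonneg (μ := volume) (f := K) hK0]
  · have split : ∫ u, (K u * -D + s.indicator K u * (η + D)) ≤ ∫ u, K u * f u := by
      refine integral_mono ((hK.mul_const _).add ((hK.indicator hs).mul_const _)) hKf fun u => ?_
      by_cases hu : u ∈ s
      · simp only [Set.indicator_of_mem hu]
        linarith [mul_le_mul_of_nonneg_left (hη u hu) (hK0 u)]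
      · simp only [Set.indicator_of_notMem hu]
        linarith [mul_le_mul_of_nonneg_left (hD u) (hK0 u)]
    rw [integral_add (hK.mul_const _) ((hK.indicator hs).mul_const _), integral_mul_const,
      integral_mul_const, integral_indicator hs] at split
    linarith [mul_le_mul_of_nonneg_right hmass (show 0 ≤ η + D by linarith)]

theorem abs_cdf_sub_cdf_le_one (μ ν : Measure ℝ) (x : ℝ) : |cdf μ x - cdf ν x| ≤ 1 :=
  (abs_sub_le_of_le_of_le (cdf_nonneg μ x) (cdf_le_one μ x) (cdf_nonneg ν x)
    (cdf_le_one ν x)).trans_eq (sub_zero 1)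

variable {μ ν : Measure ℝ} {m : ℝ}

theorem cdf_sub_cdf_le_add_of_le (hm : ∀ x y, x ≤ y → cdf ν y - cdf ν x ≤ m * (y - x)) {x y : ℝ}
    (hxy : x ≤ y) : cdf μ x - cdf ν x ≤ cdf μ y - cdf ν y + m * (y - x) := by
  linarith [hm x y hxy, monotone_cdf μ hxy]

theorem exists_abs_cdf_sub_cdf_le_add_third : ∃ C r : ℝ, 0 < C ∧ 0 < r ∧
    ∀ (μ ν : Measure ℝ) [IsProbabilityMeasure μ] [IsProbabilityMeasure ν] (m : ℝ)
      (_ : ∀ x y, x ≤ y → cdf ν y - cdf ν x ≤ m * (y - x)) (h : ℝ → ℝ)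
      (_ : IntervalIntegrable h volume (-1) 1) (_ : ∀ t, 0 ≤ h t)
      (_ : ∀ t : ℝ, |t| ≤ 1 → ‖charFun μ t - charFun ν t‖ ≤ |t| * h t)
      (D : ℝ) (_ : ∀ x, |cdf μ x - cdf ν x| ≤ D) (x : ℝ),
      |cdf μ x - cdf ν x| ≤ C * (∫ t in (-1 : ℝ)..1, h t) + 2 * r * m + D / 3 := by
  set c := ∫ u, fejerKernel u
  have hc : 0 < c := integral_fejerKernel_pos
  obtain ⟨r, hr, hmass⟩ := exists_setIntegral_Ioc_ge integrable_fejerKernel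
    (show 3 / 4 * c < c by linarith)
  refine ⟨8 / (3 * c), r, by positivity, hr, fun μ ν _ _ m hm h hh h0 hle D hD x => ?_⟩
  have hm0 : 0 ≤ m := by linarith [hm 0 1 zero_le_one, monotone_cdf ν (zero_le_one (α := ℝ))]
  have smooth := fun b => abs_le.1 (abs_integral_fejerKernel_mul_cdf_sub_le μ ν hh h0 hle b)
  have hint := integrable_mul_cdf_add_sub μ ν integrable_fejerKernel
  set J := ∫ t in (-1 : ℝ)..1, h t
  have solve : ∀ η, 3 / 4 * η * c ≤ 2 * J + D / 4 * c → η ≤ 8 / (3 * c) * J + D / 3 := by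
    intro η hη
    rw [← sub_nonneg] at hη ⊢
    have : 8 / (3 * c) * J + D / 3 - η = (2 * J + D / 4 * c - 3 / 4 * η * c) * (4 / (3 * c)) := by
      field
    rw [this]
    positivity
  have upper : cdf μ x - cdf ν x - 2 * r * m ≤ 8 / (3 * c) * J + D / 3 := by
    refine solve _ ((mul_integral_le_integral_mul_add integrable_fejerKernel fejerKernel_nonneg
      (hint (x + r)) measurableSet_Ioc hmass (fun w => (abs_le.1 (hD _)).1)
      fun w hw => ?_).trans ?_)
    · have := cdf_sub_cdf_le_add_of_le (μ := μ) hm (x := x) (y := x + r + w) (by linarith [hw.1])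
      nlinarith [hw.2]
    · linarith [(smooth (x + r)).2]
  have lower : -(cdf μ x - cdf ν x) - 2 * r * m ≤ 8 / (3 * c) * J + D / 3 := by
    refine solve _ ((mul_integral_le_integral_mul_add integrable_fejerKernel fejerKernel_nonneg
      (f := fun w => -(cdf μ (x - r + w) - cdf ν (x - r + w)))
      (by simpa only [mul_neg, Pi.neg_def] using (hint (x - r)).neg)
      measurableSet_Ioc hmass (fun w => neg_le_neg (abs_le.1 (hD _)).2) fun w hw => ?_).trans ?_)
    · have := cdf_sub_cdf_le_add_of_le (μ := μ) hm (x := x - r + w) (y := x) (by linarith [hw.2])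
      nlinarith [hw.1]
    · simp only [mul_neg, integral_neg]
      linarith [(smooth (x - r)).1]
  exact abs_le'.2 ⟨by linarith, by linarith⟩

theorem exists_abs_cdf_sub_cdf_le_integral_add : ∃ C : ℝ, 0 < C ∧
    ∀ (μ ν : Measure ℝ) [IsProbabilityMeasure μ] [IsProbabilityMeasure ν] (m : ℝ)
      (_ : ∀ x y, x ≤ y → cdf ν y - cdf ν x ≤ m * (y - x)) (h : ℝ → ℝ)
      (_ : IntervalIntegrable h volume (-1) 1) (_ : ∀ t, 0 ≤ h t)
      (_ : ∀ t : ℝ, |t| ≤ 1 → ‖charFun μ t - charFun ν t‖ ≤ |t| * h t) (x : ℝ),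
      |cdf μ x - cdf ν x| ≤ C * ((∫ t in (-1 : ℝ)..1, h t) + m) := by
  obtain ⟨C, r, hC, hr, improve⟩ := exists_abs_cdf_sub_cdf_le_add_third
  refine ⟨3 / 2 * C + 3 * r, by positivity, fun μ ν _ _ m hm h hh h0 hle x => ?_⟩
  have hm0 : 0 ≤ m := by linarith [hm 0 1 zero_le_one, monotone_cdf ν (zero_le_one (α := ℝ))]
  have hJ0 : 0 ≤ ∫ t in (-1 : ℝ)..1, h t :=
    intervalIntegral.integral_nonneg (by norm_num) fun t _ => h0 t
  set D := ⨆ x, |cdf μ x - cdf ν x|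
  have le_D : ∀ x, |cdf μ x - cdf ν x| ≤ D :=
    le_ciSup ⟨1, by rintro _ ⟨x, rfl⟩; exact abs_cdf_sub_cdf_le_one μ ν x⟩
  have D_le := ciSup_le (improve μ ν m hm h hh h0 hle D le_D)
  nlinarith [le_D x, mul_nonneg hC.le hm0, mul_nonneg hr.le hJ0]

theorem cdf_gaussianReal_sub_le {x y : ℝ} (hxy : x ≤ y) :
    cdf (gaussianReal 0 1) y - cdf (gaussianReal 0 1) x ≤ y - x := by
  have pdf_le_one : ∀ z, gaussianPDFReal 0 1 z ≤ 1 := fun z => by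
    have hconst : (√(2 * Real.pi * (1 : NNReal)))⁻¹ ≤ 1 :=
      inv_le_one_of_one_le₀ (Real.one_le_sqrt.2 (by norm_num; linarith [Real.pi_gt_three]))
    refine mul_le_one₀ hconst (Real.exp_pos _).le (Real.exp_le_one_iff.2 ?_)
    simp only [NNReal.coe_one]
    nlinarith [sq_nonneg (z - 0)]
  rw [← measureReal_Ioc_eq_cdf_sub _ hxy, measureReal_def,
    gaussianReal_apply_eq_integral _ one_ne_zero,
    ENNReal.toReal_ofReal (integral_nonneg fun _ => gaussianPDFReal_nonneg _ _ _),
    ← intervalIntegral.integral_of_le hxy]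
  calc _ ≤ ∫ _ in x..y, (1 : ℝ) := intervalIntegral.integral_mono hxy
        (integrable_gaussianPDFReal 0 1).intervalIntegrable (by simp) pdf_le_one
    _ = y - x := by simp

theorem cdf_map_mul_left (μ : Measure ℝ) [IsProbabilityMeasure μ] {T : ℝ} (hT : 0 < T) (x : ℝ) :
    cdf (μ.map (T * ·)) x = cdf μ (x / T) := by
  have hm : Measurable fun y : ℝ => T * y := measurable_const_mul T
  have := Measure.isProbabilityMeasure_map (μ := μ) hm.aemeasurable
  rw [cdf_eq_real, cdf_eq_real, map_measureReal_apply hm measurableSet_Iic]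
  congr 1
  ext y
  simp [le_div_iff₀ hT, mul_comm]

theorem exists_abs_cdf_sub_cdf_gaussianReal_le : ∃ C : ℝ, 0 < C ∧
    ∀ (μ : Measure ℝ) [IsProbabilityMeasure μ] (T : ℝ) (_ : 0 < T)
      (h : ℝ → ℝ) (_ : IntervalIntegrable h volume (-T) T) (_ : ∀ t, 0 ≤ h t)
      (_ : ∀ t : ℝ, |t| ≤ T → ‖charFun μ t - charFun (gaussianReal 0 1) t‖ ≤ |t| * h t) (x : ℝ),
      |cdf μ x - cdf (gaussianReal 0 1) x| ≤ C * ((∫ t in (-T)..T, h t) + 1 / T) := by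
  obtain ⟨C, hC, smooth⟩ := exists_abs_cdf_sub_cdf_le_integral_add
  refine ⟨C, hC, fun μ _ T hT h hh h0 hle x => ?_⟩
  have hm : Measurable fun y : ℝ => T * y := measurable_const_mul T
  have := Measure.isProbabilityMeasure_map (μ := μ) hm.aemeasurable
  have := Measure.isProbabilityMeasure_map (μ := gaussianReal 0 1) hm.aemeasurable
  have scaled := smooth (μ.map (T * ·)) ((gaussianReal 0 1).map (T * ·)) (1 / T) ?_
    (fun t => T * h (T * t)) ?_ (fun t => mul_nonneg hT.le (h0 _)) ?_ (T * x)
  · simpa [cdf_map_mul_left _ hT, mul_div_cancel_left₀ _ hT.ne'] using scaled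
  · intro x y hxy
    rw [cdf_map_mul_left _ hT, cdf_map_mul_left _ hT]
    exact (cdf_gaussianReal_sub_le (by gcongr)).trans_eq (by ring)
  · have := hh.comp_mul_left (c := T)
    rw [neg_div, div_self hT.ne'] at this
    exact this.const_mul T
  · intro t ht
    have hTt : |T * t| = T * |t| := by rw [abs_mul, abs_of_pos hT]
    rw [charFun_map_mul, charFun_map_mul]
    refine (hle (T * t) (by rw [hTt]; nlinarith)).trans_eq (by rw [hTt]; ring)

end Esseen

section CosineRecursion

theorem abs_cos_le_exp_neg {τ : ℝ} (hτ : |τ| ≤ 1) : |Real.cos τ| ≤ Real.exp (-(τ ^ 2 / 4)) := by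
  have taylor := abs_le.1 (Real.cos_bound hτ)
  have h4 : |τ| ^ 4 ≤ τ ^ 2 := by
    rw [← sq_abs τ]
    exact pow_le_pow_of_le_one (abs_nonneg _) hτ (by norm_num)
  have h2 : τ ^ 2 ≤ 1 := (sq_le_one_iff_abs_le_one τ).2 hτ
  rw [abs_of_nonneg (by linarith [taylor.1])]
  linarith [taylor.2, sq_nonneg τ, Real.add_one_le_exp (-(τ ^ 2 / 4))]

theorem abs_cos_sub_exp_neg_le (τ : ℝ) :
    |Real.cos τ - Real.exp (-(τ ^ 2 / 2))| ≤ 2 * τ ^ 4 := by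
  rcases le_total |τ| 1 with hτ | hτ
  · have h2 : τ ^ 2 ≤ 1 := (sq_le_one_iff_abs_le_one τ).2 hτ
    have cos_taylor := abs_le.1 (Real.cos_bound hτ)
    have exp_taylor := abs_le.1 <| Real.norm_exp_sub_one_sub_id_le (x := -(τ ^ 2 / 2)) (by
      rw [norm_neg, Real.norm_of_nonneg (by positivity)]
      linarith)
    rw [(show Even 4 by decide).pow_abs] at cos_taylor
    rw [norm_neg, Real.norm_of_nonneg (by positivity)] at exp_taylor
    have := pow_nonneg (sq_nonneg τ) 2
    exact abs_le.2
      ⟨by linarith [cos_taylor.1, exp_taylor.2], by linarith [cos_taylor.2, exp_taylor.1]⟩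
  · have h4 : 1 ≤ τ ^ 4 := by
      rw [← (show Even 4 by decide).pow_abs]
      exact one_le_pow₀ hτ
    have hexp : Real.exp (-(τ ^ 2 / 2)) ≤ 1 := Real.exp_le_one_iff.2 (by linarith [sq_nonneg τ])
    exact abs_le.2 ⟨by linarith [Real.neg_one_le_cos τ],
      by linarith [Real.cos_le_one τ, Real.exp_pos (-(τ ^ 2 / 2))]⟩

theorem min_mul_exp_neg_add_le {x w : ℝ} (hx0 : 0 ≤ x) (hx1 : x ≤ 1) (hw : 0 ≤ w) :
    min 8 w * Real.exp (-(x / 4)) + x ≤ min 8 (w + x) := by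
  have exp_le : Real.exp (-(x / 4)) ≤ 1 := Real.exp_le_one_iff.2 (by linarith)
  have le_exp := Real.add_one_le_exp (-(x / 4))
  have exp_mul_le : Real.exp (-(x / 4)) * (1 + x / 4) ≤ 1 := by
    rw [Real.exp_neg, inv_mul_le_iff₀ (Real.exp_pos _)]
    linarith [Real.add_one_le_exp (x / 4)]
  refine le_min ?_ ?_
  · nlinarith [mul_le_mul_of_nonneg_right (min_le_left 8 w) (Real.exp_pos (-(x / 4))).le]
  · nlinarith [min_le_right 8 w, le_min (by norm_num : (0 : ℝ) ≤ 8) hw]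

/-- The sum `a 0 ^ 2 + ⋯ + a (n - 1) ^ 2`: the variance at time `n` of a sum of independent
symmetric signs weighted by `a`. -/
def sqSum (a : ℕ → ℝ) (n : ℕ) : ℝ := ∑ k ∈ Finset.range n, a k ^ 2

theorem sqSum_zero (a : ℕ → ℝ) : sqSum a 0 = 0 := Finset.sum_range_zero _

theorem sqSum_succ (a : ℕ → ℝ) (n : ℕ) : sqSum a (n + 1) = sqSum a n + a n ^ 2 :=
  Finset.sum_range_succ _ _

theorem sqSum_nonneg (a : ℕ → ℝ) (n : ℕ) : 0 ≤ sqSum a n := Finset.sum_nonneg fun _ _ => sq_nonneg _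

theorem sqSum_mul_left (t : ℝ) (a : ℕ → ℝ) (n : ℕ) :
    sqSum (fun k => t * a k) n = t ^ 2 * sqSum a n := by
  simp only [sqSum, mul_pow, Finset.mul_sum]

variable {τ e : ℕ → ℝ} {ψ : ℕ → ℂ}

theorem norm_succ_sub_exp_le_of_norm_succ_sub_cos_mul_le
    (hψ : ∀ k, ‖ψ (k + 1) - Real.cos (τ k) * ψ k‖ ≤ 4 * τ k ^ 2 * e k + |τ k| ^ 3 * √(e k))
    (k : ℕ) :
    ‖ψ (k + 1) - Real.exp (-(sqSum τ (k + 1) / 2))‖ ≤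
      |Real.cos (τ k)| * ‖ψ k - Real.exp (-(sqSum τ k / 2))‖ +
        (4 * τ k ^ 2 * e k + |τ k| ^ 3 * √(e k) +
          2 * τ k ^ 4 * Real.exp (-(sqSum τ k / 2))) := by
  set G := Real.exp (-(sqSum τ k / 2)) with hG
  have hGsucc : Real.exp (-(sqSum τ (k + 1) / 2)) = Real.exp (-(τ k ^ 2 / 2)) * G := by
    rw [hG, ← Real.exp_add, sqSum_succ]
    ring_nf
  have split : ψ (k + 1) - Real.exp (-(sqSum τ (k + 1) / 2)) =
      Real.cos (τ k) * (ψ k - G) + (ψ (k + 1) - Real.cos (τ k) * ψ k) +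
        (((Real.cos (τ k) - Real.exp (-(τ k ^ 2 / 2))) * G : ℝ) : ℂ) := by
    rw [hGsucc]
    push_cast
    ring
  have gauss : ‖(((Real.cos (τ k) - Real.exp (-(τ k ^ 2 / 2))) * G : ℝ) : ℂ)‖ ≤
      2 * τ k ^ 4 * G := by
    rw [Complex.norm_real, norm_mul, Real.norm_of_nonneg (Real.exp_pos _).le]
    gcongr
    exact abs_cos_sub_exp_neg_le _
  rw [split]
  refine norm_add₃_le.trans ?_
  rw [norm_mul, Complex.norm_real, Real.norm_eq_abs]
  linarith [hψ k]

theorem norm_sub_exp_le_sum_of_norm_succ_sub_cos_mul_le (he : ∀ k, 0 ≤ e k) (hψ0 : ψ 0 = 1)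
    (hψ : ∀ k, ‖ψ (k + 1) - Real.cos (τ k) * ψ k‖ ≤ 4 * τ k ^ 2 * e k + |τ k| ^ 3 * √(e k))
    (k : ℕ) :
    ‖ψ k - Real.exp (-(sqSum τ k / 2))‖ ≤
      ∑ j ∈ Finset.range k, (5 * (τ j ^ 2 * e j) + 3 * τ j ^ 4) := by
  induction k with
  | zero => simp [hψ0, sqSum_zero]
  | succ k ih =>
    rw [Finset.sum_range_succ]
    have step := norm_succ_sub_exp_le_of_norm_succ_sub_cos_mul_le hψ k
    have cos_le := mul_le_of_le_one_left (norm_nonneg (ψ k - Real.exp (-(sqSum τ k / 2))))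
      (Real.abs_cos_le_one (τ k))
    have exp_le : Real.exp (-(sqSum τ k / 2)) ≤ 1 :=
      Real.exp_le_one_iff.2 (by linarith [sqSum_nonneg τ k])
    have amgm : |τ k| ^ 3 * √(e k) ≤ τ k ^ 2 * e k + τ k ^ 4 := by
      have := mul_le_mul_of_nonneg_left (two_mul_le_add_sq (|τ k|) (√(e k))) (sq_nonneg |τ k|)
      rw [Real.sq_sqrt (he k), sq_abs] at this
      have hτ3 : |τ k| ^ 3 = τ k ^ 2 * |τ k| := by rw [← sq_abs]; ring
      rw [hτ3]
      nlinarith [mul_nonneg (sq_nonneg (τ k)) (he k), pow_nonneg (sq_nonneg (τ k)) 2]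
    have := mul_le_mul_of_nonneg_left exp_le (show 0 ≤ 2 * τ k ^ 4 by positivity)
    linarith

theorem pow_four_mul_exp_le {x w S : ℝ} (hx1 : x ≤ 1) (hw : 0 ≤ w) :
    Real.exp (-(x / 4)) * (4 * S * Real.exp (-(w / 4))) + 2 * x ^ 2 * Real.exp (-(w / 2)) ≤
      4 * (S + x ^ 2) * Real.exp (-((w + x) / 4)) := by
  have hsplit : Real.exp (-((w + x) / 4)) = Real.exp (-(x / 4)) * Real.exp (-(w / 4)) := by
    rw [← Real.exp_add]
    ring_nf
  have half_le : 1 / 2 ≤ Real.exp (-(x / 4)) := by linarith [Real.add_one_le_exp (-(x / 4))]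
  have exp_le : Real.exp (-(w / 2)) ≤ Real.exp (-(w / 4)) := Real.exp_le_exp.2 (by linarith)
  have : Real.exp (-(w / 2)) ≤ 2 * Real.exp (-((w + x) / 4)) := by
    rw [hsplit]
    nlinarith [Real.exp_pos (-(w / 4))]
  have := mul_le_mul_of_nonneg_left this (sq_nonneg x)
  rw [hsplit] at this ⊢
  linarith

theorem norm_sub_exp_le_of_contraction
    (hψ : ∀ k, ‖ψ (k + 1) - Real.cos (τ k) * ψ k‖ ≤ 4 * τ k ^ 2 * e k + |τ k| ^ 3 * √(e k))
    {R ε : ℝ} {K n : ℕ} (hKn : K ≤ n) (hε : 0 ≤ ε)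
    (hR : ‖ψ K - Real.exp (-(sqSum τ K / 2))‖ ≤ R) (hτ : ∀ k, K ≤ k → k < n → |τ k| ≤ 1)
    (he : ∀ k, K ≤ k → k < n → 4 * e k + |τ k| * √(e k) ≤ ε) :
    ‖ψ n - Real.exp (-(sqSum τ n / 2))‖ ≤
      R * Real.exp (-((sqSum τ n - sqSum τ K) / 4)) + ε * min 8 (sqSum τ n) +
        4 * (∑ j ∈ Finset.range n, τ j ^ 4) * Real.exp (-(sqSum τ n / 4)) := by
  induction n, hKn using Nat.le_induction with
  | base =>
    have h1 : 0 ≤ ε * min 8 (sqSum τ K) :=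
      mul_nonneg hε (le_min (by norm_num) (sqSum_nonneg τ K))
    have h2 : 0 ≤ 4 * (∑ j ∈ Finset.range K, τ j ^ 4) * Real.exp (-(sqSum τ K / 4)) := by
      positivity
    simp only [sub_self, zero_div, neg_zero, Real.exp_zero, mul_one]
    linarith
  | succ n hn ih =>
    specialize ih (fun k hk hkn => hτ k hk (by omega)) (fun k hk hkn => he k hk (by omega))
    have step := norm_succ_sub_exp_le_of_norm_succ_sub_cos_mul_le hψ n
    have hτn := hτ n hn n.lt_succ_self
    have hx1 : τ n ^ 2 ≤ 1 := (sq_le_one_iff_abs_le_one _).2 hτn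
    have contract := mul_le_mul (abs_cos_le_exp_neg hτn) ih (norm_nonneg _) (Real.exp_pos _).le
    have initial : Real.exp (-((sqSum τ (n + 1) - sqSum τ K) / 4)) =
        Real.exp (-(τ n ^ 2 / 4)) * Real.exp (-((sqSum τ n - sqSum τ K) / 4)) := by
      rw [sqSum_succ, ← Real.exp_add]
      ring_nf
    have drift : 4 * τ n ^ 2 * e n + |τ n| ^ 3 * √(e n) ≤ ε * τ n ^ 2 := by
      have := mul_le_mul_of_nonneg_left (he n hn n.lt_succ_self) (sq_nonneg (τ n))
      rw [← sq_abs] at this ⊢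
      linarith
    have driftSum := mul_le_mul_of_nonneg_left
      (min_mul_exp_neg_add_le (sq_nonneg (τ n)) hx1 (sqSum_nonneg τ n)) hε
    have gauss := pow_four_mul_exp_le (S := ∑ j ∈ Finset.range n, τ j ^ 4) hx1 (sqSum_nonneg τ n)
    rw [← pow_mul, ← sqSum_succ] at gauss
    rw [← sqSum_succ] at driftSum
    rw [Finset.sum_range_succ, initial]
    linarith

theorem add_mul_min_sq_le {s : ℝ} (hs : 0 ≤ s) : (4 + s) * min 8 (s ^ 2) ≤ 20 * s := by
  have h3 : min 8 (s ^ 2) ≤ 3 * s := by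
    rcases le_total s 3 with h | h
    · exact (min_le_right _ _).trans (by nlinarith)
    · exact (min_le_left _ _).trans (by linarith)
  linarith [mul_le_mul_of_nonneg_left (min_le_left 8 (s ^ 2)) hs]

theorem norm_sub_exp_le_of_norm_succ_sub_cos_mul_le (he : ∀ k, 0 ≤ e k) (hψ0 : ψ 0 = 1)
    (hψ : ∀ k, ‖ψ (k + 1) - Real.cos (τ k) * ψ k‖ ≤ 4 * τ k ^ 2 * e k + |τ k| ^ 3 * √(e k))
    {η : ℝ} {K n : ℕ} (hKn : K ≤ n) (hη0 : 0 ≤ η) (hhalf : sqSum τ K ≤ sqSum τ n / 2)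
    (hτ : ∀ k, K ≤ k → k < n → |τ k| ≤ 1) (hη : ∀ k, K ≤ k → k < n → e k ≤ η)
    (hτη : ∀ k, K ≤ k → k < n → |τ k| * √(e k) ≤ √(sqSum τ n) * η) :
    ‖ψ n - Real.exp (-(sqSum τ n / 2))‖ ≤
      (5 * (∑ k ∈ Finset.range n, τ k ^ 2 * e k) + 7 * ∑ k ∈ Finset.range n, τ k ^ 4) *
        Real.exp (-(sqSum τ n / 8)) + 20 * η * √(sqSum τ n) := by
  set s := √(sqSum τ n)
  have hs : 0 ≤ s := Real.sqrt_nonneg _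
  have hs2 : s ^ 2 = sqSum τ n := Real.sq_sqrt (sqSum_nonneg τ n)
  have initial := norm_sub_exp_le_sum_of_norm_succ_sub_cos_mul_le he hψ0 hψ K
  have bound := norm_sub_exp_le_of_contraction hψ hKn (ε := η * (4 + s)) (by positivity) initial hτ
    fun k hk hkn => by linarith [hη k hk hkn, hτη k hk hkn]
  set R := ∑ j ∈ Finset.range K, (5 * (τ j ^ 2 * e j) + 3 * τ j ^ 4)
  have hterm : ∀ j, 0 ≤ 5 * (τ j ^ 2 * e j) + 3 * τ j ^ 4 := fun j => by
    have := he j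
    positivity
  have hR0 : 0 ≤ R := Finset.sum_nonneg fun j _ => hterm j
  have hR : R ≤ 5 * (∑ k ∈ Finset.range n, τ k ^ 2 * e k) + 3 * ∑ k ∈ Finset.range n, τ k ^ 4 := by
    rw [Finset.mul_sum, Finset.mul_sum, ← Finset.sum_add_distrib]
    exact Finset.sum_le_sum_of_subset_of_nonneg (Finset.range_mono hKn) fun j _ _ => hterm j
  have hS0 : 0 ≤ 4 * ∑ k ∈ Finset.range n, τ k ^ 4 := by positivity
  calc _ ≤ R * Real.exp (-(sqSum τ n / 8)) + η * (20 * s) +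
        4 * (∑ k ∈ Finset.range n, τ k ^ 4) * Real.exp (-(sqSum τ n / 8)) := by
        refine bound.trans (add_le_add_three ?_ ?_ ?_)
        · exact mul_le_mul_of_nonneg_left (Real.exp_le_exp.2 (by linarith)) hR0
        · rw [mul_assoc, ← hs2]
          exact mul_le_mul_of_nonneg_left (add_mul_min_sq_le hs) hη0
        · exact mul_le_mul_of_nonneg_left
            (Real.exp_le_exp.2 (by linarith [sqSum_nonneg τ n])) hS0
    _ ≤ _ := by linarith [mul_le_mul_of_nonneg_right hR (Real.exp_pos (-(sqSum τ n / 8))).le]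

end CosineRecursion

section CenteredSign

theorem norm_exp_mul_I_sub_one_sub_le (x : ℝ) :
    ‖Complex.exp (x * Complex.I) - 1 - x * Complex.I‖ ≤ 3 * x ^ 2 := by
  have hn : ‖(x : ℂ) * Complex.I‖ = |x| := by simp
  rcases le_total |x| 1 with h | h
  · refine (Complex.norm_exp_sub_one_sub_id_le (by rwa [hn])).trans ?_
    rw [hn, sq_abs]
    linarith [sq_nonneg x]
  · calc _ ≤ ‖Complex.exp (x * Complex.I)‖ + ‖(1 : ℂ)‖ + ‖(x : ℂ) * Complex.I‖ :=
          (norm_sub_le _ _).trans (by gcongr; exact norm_sub_le _ _)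
      _ = 1 + 1 + |x| := by rw [Complex.norm_exp_ofReal_mul_I, hn, norm_one]
      _ ≤ 3 * x ^ 2 := by rw [← sq_abs]; nlinarith

theorem abs_sin_sub_mul_cos_le (x : ℝ) : |Real.sin x - x * Real.cos x| ≤ |x| ^ 3 := by
  have sin_le := Real.abs_sub_sin_le x
  have cos_le : |x * (1 - Real.cos x)| ≤ |x| ^ 3 / 2 := by
    rw [abs_mul, abs_of_nonneg (a := 1 - Real.cos x) (by linarith [Real.cos_le_one x])]
    have := mul_le_mul_of_nonneg_left
      (show 1 - Real.cos x ≤ |x| ^ 2 / 2 by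
        rw [sq_abs]
        linarith [Real.one_sub_sq_div_two_le_cos (x := x)]) (abs_nonneg x)
    linarith
  rw [show Real.sin x - x * Real.cos x = x * (1 - Real.cos x) - (x - Real.sin x) by ring]
  refine (abs_sub _ _).trans ?_
  linarith [pow_nonneg (abs_nonneg x) 3]

theorem norm_cos_add_mul_sin_mul_I_le_one {τ m : ℝ} (hm : |m| ≤ 1) :
    ‖(Real.cos τ : ℂ) + m * Real.sin τ * Complex.I‖ ≤ 1 := by
  rw [← Complex.ofReal_mul, Complex.norm_add_mul_I, Real.sqrt_le_one]
  have hm2 : m ^ 2 ≤ 1 := (sq_le_one_iff_abs_le_one m).2 hm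
  nlinarith [sq_nonneg (Real.sin τ), Real.sin_sq_add_cos_sq τ]

theorem norm_exp_mul_cos_add_sin_sub_cos_le {τ m : ℝ} (hm : |m| ≤ 1) :
    ‖Complex.exp ((-(τ * m) : ℝ) * Complex.I) *
        (Real.cos τ + m * Real.sin τ * Complex.I) - Real.cos τ‖ ≤
      4 * τ ^ 2 * m ^ 2 + |τ| ^ 3 * |m| := by
  set R := Complex.exp ((-(τ * m) : ℝ) * Complex.I) - 1 - (-(τ * m) : ℝ) * Complex.I with hR
  have split : Complex.exp ((-(τ * m) : ℝ) * Complex.I) *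
        (Real.cos τ + m * Real.sin τ * Complex.I) - Real.cos τ =
      R * (Real.cos τ + m * Real.sin τ * Complex.I) +
        ((m * (Real.sin τ - τ * Real.cos τ) : ℝ) : ℂ) * Complex.I +
        ((τ * m ^ 2 * Real.sin τ : ℝ) : ℂ) := by
    rw [hR]
    push_cast
    linear_combination (-(τ : ℂ) * m ^ 2 * Complex.sin τ) * Complex.I_sq
  have remainder : ‖R‖ * ‖(Real.cos τ : ℂ) + m * Real.sin τ * Complex.I‖ ≤ 3 * (τ * m) ^ 2 := by
    rw [← neg_sq]
    exact (mul_le_of_le_one_right (norm_nonneg _) (norm_cos_add_mul_sin_mul_I_le_one hm)).trans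
      (norm_exp_mul_I_sub_one_sub_le (-(τ * m)))
  have linear : |m * (Real.sin τ - τ * Real.cos τ)| ≤ |τ| ^ 3 * |m| := by
    rw [abs_mul, mul_comm]
    exact mul_le_mul_of_nonneg_right (abs_sin_sub_mul_cos_le τ) (abs_nonneg m)
  have quadratic : |τ * m ^ 2 * Real.sin τ| ≤ τ ^ 2 * m ^ 2 := by
    have := mul_le_mul_of_nonneg_left (Real.abs_sin_le_abs (x := τ))
      (mul_nonneg (abs_nonneg τ) (sq_nonneg m))
    rw [abs_mul, abs_mul, abs_of_nonneg (sq_nonneg m)]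
    refine this.trans_eq ?_
    rw [← sq_abs τ]
    ring
  rw [split]
  refine norm_add₃_le.trans ?_
  rw [norm_mul, norm_mul, Complex.norm_I, Complex.norm_real, Complex.norm_real, mul_one,
    Real.norm_eq_abs, Real.norm_eq_abs]
  linarith [mul_pow τ m 2]

theorem exp_mul_I_of_eq_one_or_eq_neg_one {y : ℝ} (hy : y = 1 ∨ y = -1) (τ : ℝ) :
    Complex.exp ((τ * y : ℝ) * Complex.I) = Real.cos τ + y * Real.sin τ * Complex.I := by
  rw [Complex.exp_mul_I, ← Complex.ofReal_cos, ← Complex.ofReal_sin]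
  rcases hy with rfl | rfl <;> simp

theorem abs_eq_one_of_eq_one_or_eq_neg_one {y : ℝ} (hy : y = 1 ∨ y = -1) : |y| = 1 := by
  rcases hy with rfl | rfl <;> simp

variable {Ω : Type*} {m mΩ : MeasurableSpace Ω} {μ : Measure Ω}

theorem integral_condExp_smul {E : Type*} [NormedAddCommGroup E] [NormedSpace ℝ E]
    [CompleteSpace E] (hm : m ≤ mΩ) [SigmaFinite (μ.trim hm)]
    {Y : Ω → ℝ} {W : Ω → E} (hY : Integrable Y μ) (hYW : Integrable (fun ω => Y ω • W ω) μ)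
    (hW : AEStronglyMeasurable[m] W μ) :
    ∫ ω, μ[Y | m] ω • W ω ∂μ = ∫ ω, Y ω • W ω ∂μ := by
  rw [← integral_condExp hm (f := fun ω => Y ω • W ω)]
  exact integral_congr_ae (condExp_smul_of_aestronglyMeasurable_right hY hYW hW).symm

variable {Y Z : Ω → ℝ}

theorem ae_abs_condExp_le_one (hY : ∀ᵐ ω ∂μ, Y ω = 1 ∨ Y ω = -1) :
    ∀ᵐ ω ∂μ, |μ[Y | m] ω| ≤ 1 :=
  ae_bdd_norm_condExp_of_ae_bdd_norm (R := 1) (f := Y) (m := m)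
    (hY.mono fun _ h => (abs_eq_one_of_eq_one_or_eq_neg_one h).le)

variable [IsProbabilityMeasure μ]

theorem sq_integral_abs_le_integral_sq {f : Ω → ℝ} (hf : MemLp f 2 μ) :
    (∫ ω, |f ω| ∂μ) ^ 2 ≤ ∫ ω, f ω ^ 2 ∂μ := by
  have h := variance_nonneg |f| μ
  rw [variance_eq_sub hf.abs] at h
  simpa using h

theorem integrable_of_ae_eq_one_or_eq_neg_one (hYm : Measurable Y)
    (hY : ∀ᵐ ω ∂μ, Y ω = 1 ∨ Y ω = -1) : Integrable Y μ :=
  Integrable.of_bound hYm.aestronglyMeasurable 1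
    (hY.mono fun _ h => (abs_eq_one_of_eq_one_or_eq_neg_one h).le)

theorem exp_ofReal_add_mul_I (x y : ℝ) :
    Complex.exp ((x + y : ℝ) * Complex.I) =
      Complex.exp (x * Complex.I) * Complex.exp (y * Complex.I) := by
  rw [Complex.ofReal_add, add_mul, Complex.exp_add]

theorem integral_exp_add_mul_sub_condExp (hm : m ≤ mΩ) (hYm : Measurable Y)
    (hY : ∀ᵐ ω ∂μ, Y ω = 1 ∨ Y ω = -1) (hZ : StronglyMeasurable[m] Z) (τ : ℝ) :
    ∫ ω, Complex.exp ((Z ω + τ * (Y ω - μ[Y | m] ω) : ℝ) * Complex.I) ∂μ =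
      ∫ ω, Complex.exp (Z ω * Complex.I) * (Complex.exp ((-(τ * μ[Y | m] ω) : ℝ) * Complex.I) *
        (Real.cos τ + μ[Y | m] ω * Real.sin τ * Complex.I)) ∂μ := by
  set W : Ω → ℂ := fun ω => Complex.exp ((Z ω - τ * μ[Y | m] ω : ℝ) * Complex.I)
  have hW : StronglyMeasurable[m] W :=
    (show Continuous fun x : ℝ => Complex.exp (x * Complex.I) by fun_prop).comp_stronglyMeasurable
      (hZ.sub (stronglyMeasurable_condExp.const_mul τ))
  have hW1 : ∀ ω, ‖W ω‖ = 1 := fun ω => Complex.norm_exp_ofReal_mul_I _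
  have hWtop : MemLp W ⊤ μ := memLp_top_of_bound (hW.mono hm).aestronglyMeasurable 1
    (ae_of_all _ fun ω => (hW1 ω).le)
  have hWi : Integrable W μ := hWtop.integrable le_top
  have hYi := integrable_of_ae_eq_one_or_eq_neg_one hYm hY
  have hYW : Integrable (fun ω => Y ω • W ω) μ := hYi.smul_of_top_left hWtop
  have hmW : Integrable (fun ω => μ[Y | m] ω • W ω) μ :=
    (integrable_condExp (m := m) (f := Y)).smul_of_top_left hWtop
  calc _ = ∫ ω, (Real.cos τ * W ω + Real.sin τ * Complex.I * Y ω • W ω) ∂μ := by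
        refine integral_congr_ae (hY.mono fun ω h => ?_)
        have hexp : Complex.exp ((Z ω + τ * (Y ω - μ[Y | m] ω) : ℝ) * Complex.I) =
            W ω * Complex.exp ((τ * Y ω : ℝ) * Complex.I) := by
          rw [← exp_ofReal_add_mul_I]
          ring_nf
        simp only [hexp, exp_mul_I_of_eq_one_or_eq_neg_one h, Complex.real_smul]
        ring
    _ = ∫ ω, (Real.cos τ * W ω + Real.sin τ * Complex.I * μ[Y | m] ω • W ω) ∂μ := by
        rw [integral_add (hWi.const_mul _) (hYW.const_mul _),
          integral_add (hWi.const_mul _) (hmW.const_mul _), integral_const_mul (_ * _),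
          integral_const_mul (_ * _), integral_condExp_smul hm hYi hYW hW.aestronglyMeasurable]
    _ = _ := by
        congr 1 with ω
        have hexp : W ω = Complex.exp (Z ω * Complex.I) *
            Complex.exp ((-(τ * μ[Y | m] ω) : ℝ) * Complex.I) := by
          rw [← exp_ofReal_add_mul_I, ← sub_eq_add_neg]
        simp only [hexp, Complex.real_smul]
        ring

theorem norm_integral_exp_add_mul_sub_condExp_sub_le (hm : m ≤ mΩ) (hYm : Measurable Y)
    (hY : ∀ᵐ ω ∂μ, Y ω = 1 ∨ Y ω = -1) (hZ : StronglyMeasurable[m] Z) (τ : ℝ) {e : ℝ}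
    (he : ∫ ω, μ[Y | m] ω ^ 2 ∂μ ≤ e) :
    ‖∫ ω, Complex.exp ((Z ω + τ * (Y ω - μ[Y | m] ω) : ℝ) * Complex.I) ∂μ -
        Real.cos τ * ∫ ω, Complex.exp (Z ω * Complex.I) ∂μ‖ ≤
      4 * τ ^ 2 * e + |τ| ^ 3 * √e := by
  have hM : ∀ᵐ ω ∂μ, |μ[Y | m] ω| ≤ 1 := ae_abs_condExp_le_one hY
  have hMm : StronglyMeasurable[mΩ] μ[Y | m] := stronglyMeasurable_condExp.mono hm
  have hM2 : MemLp μ[Y | m] 2 μ := MemLp.of_bound hMm.aestronglyMeasurable 1 hM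
  have hZm := hZ.mono hm
  have abs_le : ∫ ω, |μ[Y | m] ω| ∂μ ≤ √e :=
    Real.le_sqrt_of_sq_le ((sq_integral_abs_le_integral_sq hM2).trans he)
  have hexp : Integrable (fun ω => Complex.exp (Z ω * Complex.I)) μ :=
    Integrable.of_bound (by fun_prop) 1 (ae_of_all _ fun ω => (Complex.norm_exp_ofReal_mul_I _).le)
  have hexp' : Integrable (fun ω => Complex.exp (Z ω * Complex.I) *
      (Complex.exp ((-(τ * μ[Y | m] ω) : ℝ) * Complex.I) *
        (Real.cos τ + μ[Y | m] ω * Real.sin τ * Complex.I))) μ := by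
    refine Integrable.of_bound (by fun_prop) 1 (hM.mono fun ω h => ?_)
    rw [norm_mul, norm_mul, Complex.norm_exp_ofReal_mul_I, Complex.norm_exp_ofReal_mul_I, one_mul,
      one_mul]
    exact norm_cos_add_mul_sin_mul_I_le_one h
  rw [integral_exp_add_mul_sub_condExp hm hYm hY hZ, ← integral_const_mul,
    ← integral_sub hexp' (hexp.const_mul _)]
  calc _ ≤ ∫ ω, (4 * τ ^ 2 * μ[Y | m] ω ^ 2 + |τ| ^ 3 * |μ[Y | m] ω|) ∂μ := by
        refine norm_integral_le_of_norm_le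
          ((hM2.integrable_sq.const_mul _).add ((hM2.integrable (by norm_num)).abs.const_mul _))
          (hM.mono fun ω h => ?_)
        rw [mul_comm (Real.cos τ : ℂ), ← mul_sub, norm_mul, Complex.norm_exp_ofReal_mul_I, one_mul]
        exact norm_exp_mul_cos_add_sin_sub_cos_le h
    _ = 4 * τ ^ 2 * ∫ ω, μ[Y | m] ω ^ 2 ∂μ + |τ| ^ 3 * ∫ ω, |μ[Y | m] ω| ∂μ := by
        rw [integral_add (hM2.integrable_sq.const_mul _)
          ((hM2.integrable (by norm_num)).abs.const_mul _), integral_const_mul, integral_const_mul]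
    _ ≤ _ := by gcongr

end CenteredSign

section SignMartingale

theorem integrable_abs_pow_mul_exp_neg_sq_div (n : ℕ) :
    Integrable fun u : ℝ => |u| ^ n * Real.exp (-(u ^ 2 / 8)) := by
  refine ((integrable_rpow_mul_exp_neg_mul_sq (b := 1 / 8) (by norm_num)
    (show (-1 : ℝ) < n by linarith [n.cast_nonneg (α := ℝ)])).norm).congr (ae_of_all _ fun u => ?_)
  simp only [norm_mul, Real.rpow_natCast, norm_pow, Real.norm_eq_abs, Real.abs_exp]
  ring_nf

theorem intervalIntegral_abs_pow_mul_exp_neg_sq_div_le (n : ℕ) {T : ℝ} (hT : 0 ≤ T) :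
    ∫ u in (-T)..T, |u| ^ n * Real.exp (-(u ^ 2 / 8)) ≤
      ∫ u : ℝ, |u| ^ n * Real.exp (-(u ^ 2 / 8)) := by
  rw [intervalIntegral.integral_of_le (by linarith)]
  exact setIntegral_le_integral (integrable_abs_pow_mul_exp_neg_sq_div n)
    (ae_of_all _ fun u => by positivity)

theorem exists_abs_cdf_sub_cdf_gaussianReal_le_of_norm_charFun_sub_le : ∃ C : ℝ, 0 < C ∧
    ∀ (μ : Measure ℝ) [IsProbabilityMeasure μ] (T B₁ B₂ η : ℝ) (_ : 0 < T) (_ : 0 ≤ B₁)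
      (_ : 0 ≤ B₂) (_ : 0 ≤ η)
      (_ : ∀ u : ℝ, |u| ≤ T → ‖charFun μ u - charFun (gaussianReal 0 1) u‖ ≤
        (5 * u ^ 2 * B₁ + 7 * u ^ 4 * B₂) * Real.exp (-(u ^ 2 / 8)) + 20 * η * |u|) (x : ℝ),
      |cdf μ x - cdf (gaussianReal 0 1) x| ≤ C * (B₁ + B₂ + η * T + 1 / T) := by
  obtain ⟨C, hC, esseen⟩ := exists_abs_cdf_sub_cdf_gaussianReal_le
  set I : ℕ → ℝ := fun n => ∫ u : ℝ, |u| ^ n * Real.exp (-(u ^ 2 / 8))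
  have hI : ∀ n, 0 ≤ I n := fun n => integral_nonneg fun u => by positivity
  refine ⟨C * (5 * I 1 + 7 * I 3 + 40), by have := hI 1; have := hI 3; positivity,
    fun μ _ T B₁ B₂ η hT hB₁ hB₂ hη hμ x => ?_⟩
  have intervalInt : ∀ n, IntervalIntegrable (fun u : ℝ => |u| ^ n * Real.exp (-(u ^ 2 / 8)))
      volume (-T) T := fun n => (integrable_abs_pow_mul_exp_neg_sq_div n).intervalIntegrable
  have le_I (n : ℕ) : ∫ u in (-T)..T, |u| ^ n * Real.exp (-(u ^ 2 / 8)) ≤ I n :=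
    intervalIntegral_abs_pow_mul_exp_neg_sq_div_le n hT.le
  set h : ℝ → ℝ := fun u => 5 * B₁ * (|u| ^ 1 * Real.exp (-(u ^ 2 / 8))) +
    7 * B₂ * (|u| ^ 3 * Real.exp (-(u ^ 2 / 8))) + 20 * η
  have hh := (((intervalInt 1).const_mul (5 * B₁)).add ((intervalInt 3).const_mul (7 * B₂))).add
    (intervalIntegrable_const (c := 20 * η))
  have integral_h : ∫ u in (-T)..T, h u ≤ 5 * B₁ * I 1 + 7 * B₂ * I 3 + 40 * (η * T) := by
    rw [intervalIntegral.integral_add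
        (((intervalInt 1).const_mul (5 * B₁)).add ((intervalInt 3).const_mul (7 * B₂)))
        intervalIntegrable_const,
      intervalIntegral.integral_add ((intervalInt 1).const_mul _) ((intervalInt 3).const_mul _),
      intervalIntegral.integral_const_mul, intervalIntegral.integral_const_mul,
      intervalIntegral.integral_const, smul_eq_mul]
    linarith [mul_le_mul_of_nonneg_left (le_I 1) (show 0 ≤ 5 * B₁ by positivity),
      mul_le_mul_of_nonneg_left (le_I 3) (show 0 ≤ 7 * B₂ by positivity)]
  refine (esseen μ T hT h hh (fun u => by positivity)
    (fun u hu => (hμ u hu).trans_eq ?_) x).trans ?_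
  · simp only [h]
    rw [← (show Even 4 by decide).pow_abs u, ← sq_abs u]
    ring
  · rw [mul_assoc]
    refine mul_le_mul_of_nonneg_left ?_ hC.le
    have hηT : 0 ≤ η * T := by positivity
    have hT' : 0 < 1 / T := by positivity
    nlinarith [mul_nonneg hB₁ (hI 1), mul_nonneg hB₁ (hI 3), mul_nonneg hB₂ (hI 1),
      mul_nonneg hB₂ (hI 3), mul_nonneg hηT (hI 1), mul_nonneg hηT (hI 3),
      mul_nonneg hT'.le (hI 1), mul_nonneg hT'.le (hI 3)]

variable {Ω : Type*} [mΩ : MeasurableSpace Ω] {μ : Measure Ω}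

theorem kolmogorovDist_le [IsProbabilityMeasure μ] {Y : Ω → ℝ} {B : ℝ} (hY : Measurable Y)
    (h : ∀ u, |cdf (μ.map Y) u - cdf (gaussianReal 0 1) u| ≤ B) : kolmogorovDist μ Y ≤ B := by
  have := Measure.isProbabilityMeasure_map (μ := μ) hY.aemeasurable
  refine ciSup_le fun u => ?_
  have hu := h u
  rwa [cdf_eq_real (μ.map Y), map_measureReal_apply hY measurableSet_Iic] at hu

/-- The martingale `∑_{k < n} a k (Y k - E[Y k | ℱ k])` obtained by centring the weighted partial
sums of the process `Y` conditionally on the past. -/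
def centeredSum (μ : Measure Ω) (ℱ : Filtration ℕ mΩ) (Y : ℕ → Ω → ℝ) (a : ℕ → ℝ) (n : ℕ)
    (ω : Ω) : ℝ :=
  ∑ k ∈ Finset.range n, a k * (Y k ω - μ[Y k | ℱ k] ω)

variable {ℱ : Filtration ℕ mΩ} {Y : ℕ → Ω → ℝ} {a e : ℕ → ℝ}

theorem stronglyMeasurable_centeredSum (hYm : ∀ k, Measurable[ℱ (k + 1)] (Y k)) (n : ℕ) :
    StronglyMeasurable[ℱ n] (centeredSum μ ℱ Y a n) :=
  Finset.stronglyMeasurable_fun_sum _ fun k hk =>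
    (((hYm k).stronglyMeasurable.mono (ℱ.mono (Finset.mem_range.1 hk))).sub
      (stronglyMeasurable_condExp.mono (ℱ.mono (Finset.mem_range.1 hk).le))).const_mul _

theorem measurable_centeredSum (hYm : ∀ k, Measurable[ℱ (k + 1)] (Y k)) (n : ℕ) :
    Measurable (centeredSum μ ℱ Y a n) :=
  ((stronglyMeasurable_centeredSum hYm n).mono (ℱ.le n)).measurable

variable [IsProbabilityMeasure μ]

theorem norm_charFun_map_centeredSum_succ_sub_le (hYm : ∀ k, Measurable[ℱ (k + 1)] (Y k))
    (hY : ∀ k, ∀ᵐ ω ∂μ, Y k ω = 1 ∨ Y k ω = -1) (he : ∀ k, ∫ ω, μ[Y k | ℱ k] ω ^ 2 ∂μ ≤ e k)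
    (t : ℝ) (k : ℕ) :
    ‖charFun (μ.map (centeredSum μ ℱ Y a (k + 1))) t -
        Real.cos (t * a k) * charFun (μ.map (centeredSum μ ℱ Y a k)) t‖ ≤
      4 * (t * a k) ^ 2 * e k + |t * a k| ^ 3 * √(e k) := by
  have charFun_eq : ∀ n, charFun (μ.map (centeredSum μ ℱ Y a n)) t =
      ∫ ω, Complex.exp ((t * centeredSum μ ℱ Y a n ω : ℝ) * Complex.I) ∂μ := fun n => by
    rw [charFun_apply_real, integral_map (measurable_centeredSum hYm n).aemeasurable
      (Continuous.aestronglyMeasurable (by fun_prop))]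
    push_cast
    rfl
  have succ_eq : ∀ ω, t * centeredSum μ ℱ Y a (k + 1) ω =
      t * centeredSum μ ℱ Y a k ω + t * a k * (Y k ω - μ[Y k | ℱ k] ω) := fun ω => by
    rw [centeredSum, Finset.sum_range_succ, mul_add, mul_assoc]
    rfl
  simp only [charFun_eq, succ_eq]
  exact norm_integral_exp_add_mul_sub_condExp_sub_le (ℱ.le k) ((hYm k).mono (ℱ.le _) le_rfl) (hY k)
    ((stronglyMeasurable_centeredSum hYm k).const_mul t) (t * a k) (he k)

theorem norm_charFun_map_centeredSum_sub_exp_le (hYm : ∀ k, Measurable[ℱ (k + 1)] (Y k))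
    (hY : ∀ k, ∀ᵐ ω ∂μ, Y k ω = 1 ∨ Y k ω = -1) (he : ∀ k, ∫ ω, μ[Y k | ℱ k] ω ^ 2 ∂μ ≤ e k)
    {K n : ℕ} {t η : ℝ} (hKn : K ≤ n) (hη0 : 0 ≤ η) (hhalf : sqSum a K ≤ sqSum a n / 2)
    (ht : ∀ k, K ≤ k → k < n → |t * a k| ≤ 1) (hη : ∀ k, K ≤ k → k < n → e k ≤ η)
    (haη : ∀ k, K ≤ k → k < n → |a k| * √(e k) ≤ √(sqSum a n) * η) :
    ‖charFun (μ.map (centeredSum μ ℱ Y a n)) t - Real.exp (-(t ^ 2 * sqSum a n / 2))‖ ≤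
      (5 * (t ^ 2 * ∑ k ∈ Finset.range n, a k ^ 2 * e k) +
        7 * (t ^ 4 * ∑ k ∈ Finset.range n, a k ^ 4)) * Real.exp (-(t ^ 2 * sqSum a n / 8)) +
      20 * η * (|t| * √(sqSum a n)) := by
  have he0 : ∀ k, 0 ≤ e k := fun k => (integral_nonneg fun _ => sq_nonneg _).trans (he k)
  have sqrt_eq : √(t ^ 2 * sqSum a n) = |t| * √(sqSum a n) := by
    rw [Real.sqrt_mul (sq_nonneg t), Real.sqrt_sq_eq_abs]
  have key := norm_sub_exp_le_of_norm_succ_sub_cos_mul_le (τ := fun k => t * a k)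
    (ψ := fun k => charFun (μ.map (centeredSum μ ℱ Y a k)) t) (e := e) he0
    (by
      have : centeredSum μ ℱ Y a 0 = fun _ => 0 := funext fun ω => Finset.sum_range_zero _
      simp [this])
    (norm_charFun_map_centeredSum_succ_sub_le hYm hY he t) hKn hη0
    (by
      rw [sqSum_mul_left, sqSum_mul_left]
      linarith [mul_le_mul_of_nonneg_left hhalf (sq_nonneg t)])
    ht hη
    (fun k hk hkn => by
      rw [sqSum_mul_left, sqrt_eq, abs_mul, mul_assoc, mul_assoc]
      exact mul_le_mul_of_nonneg_left (haη k hk hkn) (abs_nonneg t))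
  rw [sqSum_mul_left, sqrt_eq] at key
  simpa only [mul_pow, mul_assoc, ← Finset.mul_sum] using key

theorem exists_kolmogorovDist_centeredSum_le : ∃ C : ℝ, 0 < C ∧
    ∀ (Ω : Type*) [mΩ : MeasurableSpace Ω] (μ : Measure Ω) [IsProbabilityMeasure μ]
      (ℱ : Filtration ℕ mΩ) (Y : ℕ → Ω → ℝ) (a e : ℕ → ℝ)
      (_ : ∀ k, Measurable[ℱ (k + 1)] (Y k)) (_ : ∀ k, ∀ᵐ ω ∂μ, Y k ω = 1 ∨ Y k ω = -1)
      (_ : ∀ k, ∫ ω, μ[Y k | ℱ k] ω ^ 2 ∂μ ≤ e k) (K n : ℕ) (T η : ℝ) (_ : K ≤ n)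
      (_ : 0 < sqSum a n) (_ : sqSum a K ≤ sqSum a n / 2) (_ : 0 < T) (_ : 0 ≤ η)
      (_ : ∀ k, K ≤ k → k < n → T * |a k| ≤ √(sqSum a n)) (_ : ∀ k, K ≤ k → k < n → e k ≤ η)
      (_ : ∀ k, K ≤ k → k < n → |a k| * √(e k) ≤ √(sqSum a n) * η),
      kolmogorovDist μ (fun ω => centeredSum μ ℱ Y a n ω / √(sqSum a n)) ≤
        C * ((∑ k ∈ Finset.range n, a k ^ 2 * e k) / sqSum a n +
          (∑ k ∈ Finset.range n, a k ^ 4) / sqSum a n ^ 2 + η * T + 1 / T) := by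
  obtain ⟨C, hC, smooth⟩ := exists_abs_cdf_sub_cdf_gaussianReal_le_of_norm_charFun_sub_le
  refine ⟨C, hC, fun Ω _ μ _ ℱ Y a e hYm hY he K n T η hKn hV hhalf hT hη0 hTa hη haη => ?_⟩
  set V := sqSum a n
  set S := centeredSum μ ℱ Y a n
  have hs : 0 < √V := Real.sqrt_pos.2 hV
  have hs2 : √V ^ 2 = V := Real.sq_sqrt hV.le
  have hs4 : √V ^ 4 = V ^ 2 := by rw [pow_mul (√V) 2 2, hs2]
  have he0 : ∀ k, 0 ≤ e k := fun k => (integral_nonneg fun _ => sq_nonneg _).trans (he k)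
  have hSm : Measurable S := measurable_centeredSum hYm n
  have hSVm : Measurable fun ω => S ω / √V := hSm.div_const _
  have := Measure.isProbabilityMeasure_map (μ := μ) hSVm.aemeasurable
  refine kolmogorovDist_le hSVm (smooth _ T _ _ η hT
    (div_nonneg (Finset.sum_nonneg fun k _ => mul_nonneg (sq_nonneg _) (he0 k)) hV.le)
    (by positivity) hη0 fun u hu => ?_)
  have rescale : charFun (μ.map fun ω => S ω / √V) u = charFun (μ.map S) (u / √V) := by
    simp only [div_eq_inv_mul]
    exact charFun_map_mul_comp hSm.aemeasurable _ _
  have key := norm_charFun_map_centeredSum_sub_exp_le hYm hY he (t := u / √V) hKn hη0 hhalf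
    (fun k hk hkn => by
      rw [abs_mul, abs_div, abs_of_pos hs, div_mul_eq_mul_div, div_le_one hs]
      exact (mul_le_mul_of_nonneg_right hu (abs_nonneg _)).trans (hTa k hk hkn)) hη haη
  have normalize : (u / √V) ^ 2 * V = u ^ 2 := by
    rw [div_pow, hs2, div_mul_cancel₀ _ hV.ne']
  rw [normalize, abs_div, abs_of_pos hs, div_mul_cancel₀ _ hs.ne', ← rescale] at key
  rw [charFun_gaussianReal]
  convert key using 2
  · congr 1
    push_cast
    simp
  · rw [div_pow, div_pow, hs2, hs4]
    ring

end SignMartingale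

section Normalization

variable {p : ℝ}

theorem elephantA_pos (hp : 0 < p) {n : ℕ} (hn : 1 ≤ n) : 0 < elephantA p n := by
  have h1 : (1 : ℝ) ≤ n := by exact_mod_cast hn
  have := Real.Gamma_pos_of_pos (show (0 : ℝ) < n by linarith)
  have := Real.Gamma_pos_of_pos (show (0 : ℝ) < 2 * p by linarith)
  have := Real.Gamma_pos_of_pos (show (0 : ℝ) < n + 2 * p - 1 by linarith)
  unfold elephantA
  positivity

theorem elephantA_succ_mul (hp : 0 < p) {n : ℕ} (hn : 1 ≤ n) :
    elephantA p (n + 1) * (1 + (2 * p - 1) / n) = elephantA p n := by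
  have h1 : (1 : ℝ) ≤ n := by exact_mod_cast hn
  have hn0 : (n : ℝ) ≠ 0 := by positivity
  have harg : (n : ℝ) + 2 * p - 1 ≠ 0 := by linarith
  have hΓ := (Real.Gamma_pos_of_pos (show (0 : ℝ) < n + 2 * p - 1 by linarith)).ne'
  unfold elephantA
  rw [show ((n + 1 : ℕ) : ℝ) + 2 * p - 1 = (n + 2 * p - 1) + 1 by push_cast; ring,
    Real.Gamma_add_one harg, Nat.cast_add_one, Real.Gamma_add_one hn0]
  field_simp
  ring

theorem elephantV_eq_sqSum (p : ℝ) (n : ℕ) :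
    elephantV p n = sqSum (fun k => elephantA p (k + 1)) n := by
  rw [elephantV, sqSum, Finset.range_eq_Ico,
    Finset.sum_Ico_add' (fun k => elephantA p k ^ 2) 0 n 1, ← Finset.Ico_succ_right_eq_Icc]
  rfl

theorem elephantV_succ (p : ℝ) (n : ℕ) :
    elephantV p (n + 1) = elephantV p n + elephantA p (n + 1) ^ 2 :=
  Finset.sum_Icc_succ_top (by omega) _

theorem elephantV_one (hp : 0 < p) : elephantV p 1 = 1 := by
  simp [elephantV, elephantA_one p hp]

theorem elephantV_mono (p : ℝ) : Monotone (elephantV p) :=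
  monotone_nat_of_le_succ fun n => by
    rw [elephantV_succ]
    linarith [sq_nonneg (elephantA p (n + 1))]

theorem one_le_elephantV (hp : 0 < p) {n : ℕ} (hn : 1 ≤ n) : 1 ≤ elephantV p n :=
  (elephantV_one hp).symm.le.trans (elephantV_mono p hn)

/-- The bound `v_k / (a_k k) ^ 2` for the mean square of the conditional mean of step `k + 1`
given the first `k` steps. -/
def elephantDrift (p : ℝ) (k : ℕ) : ℝ :=
  if k = 0 then 1 else elephantV p k / (elephantA p k * k) ^ 2

end Normalization

section Sign

variable {Ω : Type*} [MeasurableSpace Ω] {μ : Measure Ω} [IsProbabilityMeasure μ] {Y : Ω → ℝ}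
  {q : ℝ}

theorem ae_eq_one_or_eq_neg_one (hY : Measurable Y) (h1 : μ.real {ω | Y ω = 1} = q)
    (h2 : μ.real {ω | Y ω = -1} = 1 - q) : ∀ᵐ ω ∂μ, Y ω = 1 ∨ Y ω = -1 := by
  have m1 : MeasurableSet {ω | Y ω = 1} := hY (measurableSet_singleton 1)
  have m2 : MeasurableSet {ω | Y ω = -1} := hY (measurableSet_singleton (-1))
  have disjoint : Disjoint {ω | Y ω = 1} {ω | Y ω = -1} :=
    Set.disjoint_left.2 fun ω (h : Y ω = 1) (h' : Y ω = -1) => by norm_num [h] at h'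
  have total : μ.real ({ω | Y ω = 1} ∪ {ω | Y ω = -1}) = 1 := by
    rw [measureReal_union disjoint m2, h1, h2, add_sub_cancel]
  rw [measureReal_def, ENNReal.toReal_eq_one_iff] at total
  exact (mem_ae_iff_prob_eq_one (m1.union m2)).2 total

theorem integral_of_eq_one_or_eq_neg_one (hY : Measurable Y) (h1 : μ.real {ω | Y ω = 1} = q)
    (h2 : μ.real {ω | Y ω = -1} = 1 - q) : ∫ ω, Y ω ∂μ = 2 * q - 1 := by
  have m1 : MeasurableSet {ω | Y ω = 1} := hY (measurableSet_singleton 1)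
  have m2 : MeasurableSet {ω | Y ω = -1} := hY (measurableSet_singleton (-1))
  have as_indicator : ∫ ω, Y ω ∂μ = ∫ ω, ({ω | Y ω = 1}.indicator (fun _ => (1 : ℝ)) ω -
      {ω | Y ω = -1}.indicator (fun _ => (1 : ℝ)) ω) ∂μ := by
    refine integral_congr_ae ((ae_eq_one_or_eq_neg_one hY h1 h2).mono fun ω hω => ?_)
    rcases hω with h | h <;> simp only [Set.indicator, Set.mem_ofPred_eq, h] <;> norm_num
  rw [as_indicator, integral_sub ((integrable_const 1).indicator m1)
    ((integrable_const 1).indicator m2), integral_indicator_const _ m1,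
    integral_indicator_const _ m2, h1, h2, smul_eq_mul, smul_eq_mul]
  ring

end Sign

section Past

variable {Ω : Type*} [mΩ : MeasurableSpace Ω] {X : ℕ → Ω → ℝ}

/-- The filtration whose `n`-th σ-algebra is generated by `X 1, …, X n`; the value `X 0` is ignored,
as in `IsElephantWalk`. -/
def stepFiltration (X : ℕ → Ω → ℝ) (hX : ∀ n, Measurable (X n)) : Filtration ℕ mΩ where
  seq n := MeasurableSpace.comap (fun ω (i : Finset.Icc 1 n) => X i ω) inferInstance
  mono' m n hmn := by
    let restrict (x : Finset.Icc 1 n → ℝ) (i : Finset.Icc 1 m) : ℝ :=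
      x ⟨i, Finset.Icc_subset_Icc_right hmn i.2⟩
    have restrict_measurable : Measurable restrict :=
      measurable_pi_lambda _ fun _ => measurable_pi_apply _
    exact (restrict_measurable.comp
      (comap_measurable fun ω (i : Finset.Icc 1 n) => X i ω)).comap_le
  le' n := (measurable_pi_lambda _ fun i : Finset.Icc 1 n => hX i).comap_le

variable (hX : ∀ n, Measurable (X n))

theorem measurable_stepFiltration {k n : ℕ} (hk : k ∈ Finset.Icc 1 n) :
    Measurable[stepFiltration X hX n] (X k) :=
  (measurable_pi_apply (X := fun _ : Finset.Icc 1 n => ℝ) ⟨k, hk⟩).comp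
    (comap_measurable fun ω (i : Finset.Icc 1 n) => X i ω)

theorem stepFiltration_zero : stepFiltration X hX 0 = (⊥ : MeasurableSpace Ω) := by
  have : (fun ω (i : Finset.Icc 1 0) => X i ω) = fun _ i => absurd i.2 (by simp) := by
    funext ω i
    exact absurd i.2 (by simp)
  change MeasurableSpace.comap _ _ = _
  rw [this, MeasurableSpace.comap_const]

end Past

section Walk

theorem elephantPosition_succ {Ω : Type*} (X : ℕ → Ω → ℝ) (n : ℕ) (ω : Ω) :
    elephantPosition X (n + 1) ω = elephantPosition X n ω + X (n + 1) ω :=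
  Finset.sum_Icc_succ_top (by omega) _

variable {Ω : Type*} [MeasurableSpace Ω] {μ : Measure Ω} {p q : ℝ} {X α : ℕ → Ω → ℝ}
  {β : ℕ → Ω → ℕ}

namespace IsElephantWalk

theorem measurable_position (hw : IsElephantWalk μ p q X α β) (n : ℕ) :
    Measurable (elephantPosition X n) :=
  Finset.measurable_fun_sum _ fun k _ => hw.measurable_step k

variable [IsProbabilityMeasure μ]

theorem ae_memory (hw : IsElephantWalk μ p q X α β) {n : ℕ} (hn : 1 ≤ n) :
    ∀ᵐ ω ∂μ, β (n + 1) ω ∈ Finset.Icc 1 n := by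
  have measurableSet_memory (k) : MeasurableSet {ω | β (n + 1) ω = k} :=
    hw.measurable_memory (n + 1) (measurableSet_singleton k)
  have total : μ.real (⋃ k ∈ Finset.Icc 1 n, {ω | β (n + 1) ω = k}) = 1 := by
    rw [measureReal_biUnion_finset _ fun k _ => measurableSet_memory k,
      Finset.sum_congr rfl (hw.memory_uniform n hn)]
    · simp [show (n : ℝ) ≠ 0 by positivity]
    · exact fun i _ j _ hij => Set.disjoint_left.2 fun ω hi hj => hij (hi.symm.trans hj)
  rw [measureReal_def, ENNReal.toReal_eq_one_iff] at total
  have ae_union := (mem_ae_iff_prob_eq_one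
    (Finset.measurableSet_biUnion _ fun k _ => measurableSet_memory k)).2 total
  filter_upwards [ae_union] with ω hω
  simpa using hω

theorem ae_sign (hw : IsElephantWalk μ p q X α β) {n : ℕ} (hn : 1 ≤ n) :
    ∀ᵐ ω ∂μ, α (n + 1) ω = 1 ∨ α (n + 1) ω = -1 :=
  ae_eq_one_or_eq_neg_one (hw.measurable_sign _) (hw.sign_pos n hn) (hw.sign_neg n hn)

theorem ae_step (hw : IsElephantWalk μ p q X α β) {n : ℕ} (hn : 1 ≤ n) :
    ∀ᵐ ω ∂μ, X n ω = 1 ∨ X n ω = -1 := by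
  induction n using Nat.strong_induction_on with
  | _ n ih =>
    obtain rfl | ⟨m, hm, rfl⟩ : n = 1 ∨ ∃ m, 1 ≤ m ∧ n = m + 1 := by
      rcases hn.eq_or_lt with h | h
      · exact .inl h.symm
      · exact .inr ⟨n - 1, by omega, by omega⟩
    · exact ae_eq_one_or_eq_neg_one (hw.measurable_step 1) hw.first_step_pos hw.first_step_neg
    · have ae_past : ∀ᵐ ω ∂μ, ∀ k ∈ Finset.Icc 1 m, X k ω = 1 ∨ X k ω = -1 :=
        (Finset.eventually_all _).2 fun k hk =>
          ih k (by grind) (Finset.mem_Icc.1 hk).1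
      filter_upwards [ae_past, hw.step_succ m hm, hw.ae_memory hm, hw.ae_sign hm]
        with ω past step memory sign
      rw [step]
      rcases sign with h | h <;> rcases past _ memory with h' | h' <;> simp [h, h']

theorem integrable_step (hw : IsElephantWalk μ p q X α β) {n : ℕ} (hn : 1 ≤ n) :
    Integrable (X n) μ :=
  integrable_of_ae_eq_one_or_eq_neg_one (hw.measurable_step n) (hw.ae_step hn)

theorem ae_abs_position_le (hw : IsElephantWalk μ p q X α β) (n : ℕ) :
    ∀ᵐ ω ∂μ, |elephantPosition X n ω| ≤ n := by
  have ae_past : ∀ᵐ ω ∂μ, ∀ k ∈ Finset.Icc 1 n, X k ω = 1 ∨ X k ω = -1 :=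
    (Finset.eventually_all _).2 fun k hk => hw.ae_step (Finset.mem_Icc.1 hk).1
  filter_upwards [ae_past] with ω past
  calc |elephantPosition X n ω| ≤ ∑ k ∈ Finset.Icc 1 n, |X k ω| := Finset.abs_sum_le_sum_abs _ _
    _ = ∑ _k ∈ Finset.Icc 1 n, 1 :=
      Finset.sum_congr rfl fun k hk => abs_eq_one_of_eq_one_or_eq_neg_one (past k hk)
    _ = n := by simp

theorem integrable_position_sq (hw : IsElephantWalk μ p q X α β) (n : ℕ) :
    Integrable (fun ω => elephantPosition X n ω ^ 2) μ := by
  refine Integrable.of_bound ((hw.measurable_position n).pow_const 2).aestronglyMeasurable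
    ((n : ℝ) ^ 2) ((hw.ae_abs_position_le n).mono fun ω h => ?_)
  rw [norm_pow, Real.norm_eq_abs]
  gcongr

theorem abs_two_mul_sub_one_le (hw : IsElephantWalk μ p q X α β) : |2 * p - 1| ≤ 1 := by
  have h0 : 0 ≤ p := hw.sign_pos 1 le_rfl ▸ measureReal_nonneg
  have h1 : p ≤ 1 := hw.sign_pos 1 le_rfl ▸ measureReal_le_one
  rw [abs_le]
  constructor <;> linarith

theorem integral_memory_indicator_mul_sign (hw : IsElephantWalk μ p q X α β) {n : ℕ} (hn : 1 ≤ n)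
    {k : ℕ} (hk : k ∈ Finset.Icc 1 n) :
    ∫ ω, {ω | β (n + 1) ω = k}.indicator (α (n + 1)) ω ∂μ = (2 * p - 1) / n := by
  have hmk : MeasurableSet {ω | β (n + 1) ω = k} :=
    hw.measurable_memory (n + 1) (measurableSet_singleton k)
  let isMemory : ℕ → ℝ := ({k} : Set ℕ).indicator fun _ => 1
  have measurable_isMemory : Measurable isMemory := measurable_from_nat
  have as_product (ω) : {ω | β (n + 1) ω = k}.indicator (α (n + 1)) ω =
      α (n + 1) ω * isMemory (β (n + 1) ω) := by
    by_cases h : β (n + 1) ω = k <;> simp [isMemory, h]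
  have integral_isMemory : ∫ ω, isMemory (β (n + 1) ω) ∂μ = 1 / n :=
    (integral_indicator_one hmk).trans (hw.memory_uniform n hn k hk)
  have indep : IndepFun (α (n + 1)) (fun ω => isMemory (β (n + 1) ω)) μ :=
    (hw.indep_sign_memory n hn).comp measurable_id measurable_isMemory
  simp only [as_product]
  rw [indep.integral_fun_mul_eq_mul_integral (hw.measurable_sign _).aestronglyMeasurable
    (measurable_isMemory.comp (hw.measurable_memory _)).aestronglyMeasurable, integral_isMemory,
    integral_of_eq_one_or_eq_neg_one (hw.measurable_sign _) (hw.sign_pos n hn) (hw.sign_neg n hn)]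
  ring

theorem condExp_memory_indicator_mul_sign (hw : IsElephantWalk μ p q X α β) {n : ℕ} (hn : 1 ≤ n)
    {k : ℕ} (hk : k ∈ Finset.Icc 1 n) :
    μ[{ω | β (n + 1) ω = k}.indicator (α (n + 1))|stepFiltration X hw.measurable_step n] =ᵐ[μ]
      fun _ => (2 * p - 1) / n := by
  let Z : Ω → ℝ × ℕ := fun ω => (α (n + 1) ω, β (n + 1) ω)
  have hZ : Measurable Z := (hw.measurable_sign _).prodMk (hw.measurable_memory _)
  have measurable_Z :
      Measurable[MeasurableSpace.comap Z inferInstance]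
        ({ω | β (n + 1) ω = k}.indicator (α (n + 1))) :=
    (measurable_fst.indicator (measurable_snd (measurableSet_singleton k))).comp
      (comap_measurable Z)
  rw [← hw.integral_memory_indicator_mul_sign hn hk]
  exact condExp_indep_eq hZ.comap_le ((stepFiltration X hw.measurable_step).le n)
    measurable_Z.stronglyMeasurable (hw.indep_past n hn)

theorem condExp_step (hw : IsElephantWalk μ p q X α β) {n : ℕ} (hn : 1 ≤ n) :
    μ[X (n + 1)|stepFiltration X hw.measurable_step n] =ᵐ[μ]
      fun ω => (2 * p - 1) / n * elephantPosition X n ω := by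
  set ℱ := stepFiltration X hw.measurable_step
  let S : ℕ → Ω → ℝ := fun k => {ω | β (n + 1) ω = k}.indicator (α (n + 1))
  have integrable_S (k) : Integrable (S k) μ :=
    (integrable_of_ae_eq_one_or_eq_neg_one (hw.measurable_sign _) (hw.ae_sign hn)).indicator
      (hw.measurable_memory (n + 1) (measurableSet_singleton k))
  have integrable_SX : ∀ k ∈ Finset.Icc 1 n, Integrable (S k * X k) μ := fun k hk =>
    (integrable_S k).mul_bdd (c := 1) (hw.measurable_step k).aestronglyMeasurable
      ((hw.ae_step (Finset.mem_Icc.1 hk).1).mono fun ω h =>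
        (abs_eq_one_of_eq_one_or_eq_neg_one h).le)
  have decomposition : X (n + 1) =ᵐ[μ] ∑ k ∈ Finset.Icc 1 n, S k * X k := by
    filter_upwards [hw.step_succ n hn, hw.ae_memory hn] with ω step memory
    rw [Finset.sum_apply, Finset.sum_eq_single_of_mem _ memory fun k _ hk => by
      simp [S, hk.symm], step]
    simp [S]
  have condExp_SX : ∀ k ∈ Finset.Icc 1 n,
      μ[S k * X k|ℱ n] =ᵐ[μ] fun ω => (2 * p - 1) / n * X k ω := fun k hk => by
    filter_upwards [condExp_mul_of_stronglyMeasurable_right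
      (measurable_stepFiltration hw.measurable_step hk).stronglyMeasurable (integrable_SX k hk)
      (integrable_S k), hw.condExp_memory_indicator_mul_sign hn hk] with ω pull_out mean
    rw [pull_out, Pi.mul_apply, mean]
  filter_upwards [condExp_congr_ae decomposition, condExp_finsetSum integrable_SX (ℱ n),
    (Finset.eventually_all _).2 condExp_SX] with ω h1 h2 h3
  rw [h1, h2, Finset.sum_apply, Finset.sum_congr rfl h3, elephantPosition, Finset.mul_sum]

theorem condExp_first_step (hw : IsElephantWalk μ p q X α β) :
    μ[X 1|stepFiltration X hw.measurable_step 0] = fun _ => 2 * q - 1 := by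
  rw [stepFiltration_zero, condExp_bot, integral_of_eq_one_or_eq_neg_one (hw.measurable_step 1)
    hw.first_step_pos hw.first_step_neg]

end IsElephantWalk

end Walk

section SecondMoment

variable {Ω : Type*} [MeasurableSpace Ω] {μ : Measure Ω} [IsProbabilityMeasure μ] {p q : ℝ}
  {X α : ℕ → Ω → ℝ} {β : ℕ → Ω → ℕ}

namespace IsElephantWalk

theorem integrable_step_mul_position (hw : IsElephantWalk μ p q X α β) (n : ℕ) :
    Integrable (fun ω => X (n + 1) ω * elephantPosition X n ω) μ :=
  (hw.integrable_step n.succ_pos).mul_bdd (c := n) (hw.measurable_position n).aestronglyMeasurable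
    (hw.ae_abs_position_le n)

theorem integral_step_mul_position (hw : IsElephantWalk μ p q X α β) {n : ℕ} (hn : 1 ≤ n) :
    ∫ ω, X (n + 1) ω * elephantPosition X n ω ∂μ =
      (2 * p - 1) / n * ∫ ω, elephantPosition X n ω ^ 2 ∂μ := by
  have measurable_past : Measurable[stepFiltration X hw.measurable_step n]
      (elephantPosition X n) :=
    Finset.measurable_fun_sum _ fun k hk => measurable_stepFiltration hw.measurable_step hk
  calc ∫ ω, X (n + 1) ω * elephantPosition X n ω ∂μ
      = ∫ ω, μ[X (n + 1)|stepFiltration X hw.measurable_step n] ω * elephantPosition X n ω ∂μ :=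
        (integral_condExp_smul ((stepFiltration X hw.measurable_step).le n)
          (hw.integrable_step n.succ_pos) (hw.integrable_step_mul_position n)
          measurable_past.stronglyMeasurable.aestronglyMeasurable).symm
    _ = ∫ ω, (2 * p - 1) / n * elephantPosition X n ω ^ 2 ∂μ :=
        integral_congr_ae ((hw.condExp_step hn).mono fun ω h => by
          simp only [h]
          ring)
    _ = (2 * p - 1) / n * ∫ ω, elephantPosition X n ω ^ 2 ∂μ := integral_const_mul _ _

theorem integral_position_sq_succ (hw : IsElephantWalk μ p q X α β) {n : ℕ} (hn : 1 ≤ n) :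
    ∫ ω, elephantPosition X (n + 1) ω ^ 2 ∂μ =
      (1 + 2 * ((2 * p - 1) / n)) * ∫ ω, elephantPosition X n ω ^ 2 ∂μ + 1 := by
  have expansion : ∀ᵐ ω ∂μ, elephantPosition X (n + 1) ω ^ 2 =
      elephantPosition X n ω ^ 2 + 2 * (X (n + 1) ω * elephantPosition X n ω) + 1 := by
    filter_upwards [hw.ae_step n.succ_pos] with ω step
    rw [elephantPosition_succ]
    rcases step with h | h <;> rw [h] <;> ring
  have integrable_mul := (hw.integrable_step_mul_position n).const_mul 2
  have integrable_add : Integrable (fun ω => elephantPosition X n ω ^ 2 +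
      2 * (X (n + 1) ω * elephantPosition X n ω)) μ :=
    (hw.integrable_position_sq n).add integrable_mul
  rw [integral_congr_ae expansion, integral_add integrable_add (integrable_const 1),
    integral_add (hw.integrable_position_sq n) integrable_mul, integral_const_mul,
    hw.integral_step_mul_position hn, integral_const, probReal_univ, one_smul]
  ring

theorem integral_position_sq_le (hw : IsElephantWalk μ p q X α β) (hp : 0 < p) {n : ℕ}
    (hn : 1 ≤ n) : elephantA p n ^ 2 * ∫ ω, elephantPosition X n ω ^ 2 ∂μ ≤ elephantV p n := by
  induction n, hn using Nat.le_induction with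
  | base =>
    have sq_first : ∀ᵐ ω ∂μ, elephantPosition X 1 ω ^ 2 = 1 := by
      filter_upwards [hw.ae_step le_rfl] with ω step
      simpa [elephantPosition] using step
    simp [integral_congr_ae sq_first, elephantV_one hp, elephantA_one p hp]
  | succ n hn ih =>
    have second_moment_nonneg : 0 ≤ ∫ ω, elephantPosition X n ω ^ 2 ∂μ :=
      integral_nonneg fun _ => sq_nonneg _
    have weight_le : elephantA p (n + 1) ^ 2 * (1 + 2 * ((2 * p - 1) / n)) ≤
        elephantA p n ^ 2 := by
      rw [← elephantA_succ_mul hp hn, mul_pow]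
      gcongr
      linarith [sq_nonneg ((2 * p - 1) / (n : ℝ))]
    rw [hw.integral_position_sq_succ hn, elephantV_succ]
    linarith [mul_le_mul_of_nonneg_right weight_le second_moment_nonneg]

theorem integral_condExp_step_sq_le (hw : IsElephantWalk μ p q X α β) (hp : 0 < p) (k : ℕ) :
    ∫ ω, μ[X (k + 1)|stepFiltration X hw.measurable_step k] ω ^ 2 ∂μ ≤ elephantDrift p k := by
  rcases Nat.eq_zero_or_pos k with rfl | hk
  · have sq_le_one : (2 * q - 1) ^ 2 ≤ 1 := by
      have h0 : 0 ≤ q := hw.first_step_pos ▸ measureReal_nonneg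
      have h1 : q ≤ 1 := hw.first_step_pos ▸ measureReal_le_one
      nlinarith
    simpa [hw.condExp_first_step, elephantDrift] using sq_le_one
  · have : (0 : ℝ) < k := Nat.cast_pos.2 hk
    have ha := elephantA_pos hp hk
    have hm : (2 * p - 1) ^ 2 ≤ 1 := (sq_le_one_iff_abs_le_one _).2 hw.abs_two_mul_sub_one_le
    calc ∫ ω, μ[X (k + 1)|stepFiltration X hw.measurable_step k] ω ^ 2 ∂μ
        = (2 * p - 1) ^ 2 * (∫ ω, elephantPosition X k ω ^ 2 ∂μ) / k ^ 2 := by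
          rw [integral_congr_ae ((hw.condExp_step hk).mono fun ω h => congrArg (· ^ 2) h)]
          simp only [mul_pow, div_pow]
          rw [integral_const_mul]
          ring
      _ ≤ 1 * (elephantV p k / elephantA p k ^ 2) / k ^ 2 := by
          gcongr
          exact (le_div_iff₀' (by positivity)).2 (hw.integral_position_sq_le hp hk)
      _ = elephantDrift p k := by
          rw [elephantDrift, if_neg hk.ne']
          field_simp

end IsElephantWalk

end SecondMoment

section Martingale

variable {Ω : Type*} [MeasurableSpace Ω] {μ : Measure Ω} {p q : ℝ} {X α : ℕ → Ω → ℝ}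
  {β : ℕ → Ω → ℕ}

theorem kolmogorovDist_congr {Y Z : Ω → ℝ} (h : Y =ᵐ[μ] Z) :
    kolmogorovDist μ Y = kolmogorovDist μ Z := by
  unfold kolmogorovDist
  congr! 4 with u
  exact measureReal_congr (h.mono fun ω hω => congrArg (· ≤ u) hω)

theorem IsElephantWalk.centeredSum_ae_eq [IsProbabilityMeasure μ]
    (hw : IsElephantWalk μ p q X α β) (hp : 0 < p) {n : ℕ} (hn : 1 ≤ n) :
    centeredSum μ (stepFiltration X hw.measurable_step) (fun k => X (k + 1))
        (fun k => elephantA p (k + 1)) n =ᵐ[μ]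
      fun ω => elephantA p n * elephantPosition X n ω - (2 * q - 1) := by
  induction n, hn using Nat.le_induction with
  | base =>
    exact ae_of_all _ fun ω => by
      simp [centeredSum, hw.condExp_first_step, elephantA_one p hp, elephantPosition]
  | succ n hn ih =>
    filter_upwards [ih, hw.condExp_step hn] with ω sum_eq mean_eq
    rw [centeredSum, Finset.sum_range_succ, mean_eq, elephantPosition_succ]
    rw [centeredSum] at sum_eq
    linear_combination sum_eq - elephantPosition X n ω * elephantA_succ_mul hp hn

/-- `ε` bounds the Kolmogorov distance between the standard normal law and the normalized position
at time `n` of an elephant random walk with memory parameter `p`, uniformly in the first-step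
parameter `q` and in the probability space. -/
def IsElephantKolmogorovBound.{u} (p : ℝ) (n : ℕ) (ε : ℝ) : Prop :=
  ∀ (Ω : Type u) [MeasurableSpace Ω] (μ : Measure Ω) [IsProbabilityMeasure μ] (q : ℝ)
    (X α : ℕ → Ω → ℝ) (β : ℕ → Ω → ℕ), IsElephantWalk μ p q X α β →
    kolmogorovDist μ (fun ω =>
      (elephantA p n * elephantPosition X n ω - (2 * q - 1)) / √(elephantV p n)) ≤ ε

theorem IsElephantKolmogorovBound.mono.{u} {n : ℕ} {ε ε' : ℝ}
    (h : IsElephantKolmogorovBound.{u} p n ε) (hε : ε ≤ ε') :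
    IsElephantKolmogorovBound.{u} p n ε' :=
  fun Ω _ μ _ q X α β hw => (h Ω μ q X α β hw).trans hε

theorem exists_isElephantKolmogorovBound : ∃ C : ℝ, 0 < C ∧
    ∀ (p : ℝ) (_ : 0 < p) (n K : ℕ) (_ : 1 ≤ n) (_ : K ≤ n)
      (_ : elephantV p K ≤ elephantV p n / 2) (T η : ℝ) (_ : 0 < T) (_ : 0 ≤ η)
      (_ : ∀ k, K ≤ k → k < n → T * elephantA p (k + 1) ≤ √(elephantV p n))
      (_ : ∀ k, K ≤ k → k < n → elephantDrift p k ≤ η)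
      (_ : ∀ k, K ≤ k → k < n →
        elephantA p (k + 1) * √(elephantDrift p k) ≤ √(elephantV p n) * η),
      IsElephantKolmogorovBound p n (C *
        ((∑ k ∈ Finset.range n, elephantA p (k + 1) ^ 2 * elephantDrift p k) / elephantV p n +
          (∑ k ∈ Finset.range n, elephantA p (k + 1) ^ 4) / elephantV p n ^ 2 + η * T +
            1 / T)) := by
  obtain ⟨C, hC, bound⟩ := exists_kolmogorovDist_centeredSum_le
  refine ⟨C, hC, ?_⟩
  intro p hp n K hn hKn hhalf T η hT hη0 hTa hη haη Ω _ μ _ q X α β hw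
  have abs_a (k) : |elephantA p (k + 1)| = elephantA p (k + 1) :=
    abs_of_pos (elephantA_pos hp k.succ_pos)
  have hV : 0 < elephantV p n := one_pos.trans_le (one_le_elephantV hp hn)
  rw [← kolmogorovDist_congr ((hw.centeredSum_ae_eq hp hn).mono fun ω h =>
    congrArg (· / √(elephantV p n)) h)]
  simp only [elephantV_eq_sqSum] at *
  exact bound Ω μ _ _ _ (elephantDrift p)
    (fun k => measurable_stepFiltration hw.measurable_step (by simp))
    (fun k => hw.ae_step k.succ_pos) (hw.integral_condExp_step_sq_le hp) K n T η hKn hV hhalf hT hη0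
    (by simpa only [abs_a] using hTa) hη (by simpa only [abs_a] using haη)

end Martingale

section Asymptotics

variable {p : ℝ}

theorem elephantA_succ (hp : 0 < p) (n : ℕ) :
    elephantA p (n + 1) = n.factorial / ∏ j ∈ Finset.range n, (2 * p + j) := by
  induction n with
  | zero => simp [elephantA_one p hp]
  | succ n ih =>
    have prod_ne : ∏ j ∈ Finset.range n, (2 * p + (j : ℝ)) ≠ 0 :=
      (Finset.prod_pos fun j _ => by positivity).ne'
    have recursion := elephantA_succ_mul hp n.succ_pos
    have factor : 1 + (2 * p - 1) / ((n.succ : ℕ) : ℝ) = (2 * p + n) / (n + 1) := by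
      push_cast
      field_simp
      ring
    rw [factor, ih, ← eq_div_iff (by positivity)] at recursion
    rw [recursion, Finset.prod_range_succ, Nat.factorial_succ]
    push_cast
    field_simp

theorem tendsto_elephantA_mul_rpow (hp : 0 < p) :
    Tendsto (fun n : ℕ => elephantA p n * (n : ℝ) ^ (2 * p - 1)) atTop
      (𝓝 (Real.Gamma (2 * p))) := by
  have tendsto_factor (c : ℝ) : Tendsto (fun n : ℕ => 1 + c / n) atTop (𝓝 1) := by
    simpa using (tendsto_const_div_atTop_nhds_zero_nat c).const_add 1
  have limit := ((Real.GammaSeq_tendsto_Gamma (2 * p)).mul (tendsto_factor (2 * p - 1))).mul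
    (tendsto_factor (2 * p))
  rw [mul_one, mul_one] at limit
  refine limit.congr' ?_
  filter_upwards [eventually_gt_atTop 0] with n hn
  have prod_ne : ∏ j ∈ Finset.range n, (2 * p + (j : ℝ)) ≠ 0 :=
    (Finset.prod_pos fun j _ => by positivity).ne'
  rw [← elephantA_succ_mul hp hn, elephantA_succ hp, Real.GammaSeq, Finset.prod_range_succ,
    Real.rpow_sub_one (by positivity)]
  field_simp
  ring

theorem exists_pos_bounds_of_tendsto {u : ℕ → ℝ} {l : ℝ} (hu : ∀ n, 0 < u n) (hl : 0 < l)
    (h : Tendsto u atTop (𝓝 l)) : ∃ c C : ℝ, 0 < c ∧ 0 < C ∧ ∀ n, c ≤ u n ∧ u n ≤ C := by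
  obtain ⟨C, hC⟩ := h.bddAbove_range
  obtain ⟨D, hD⟩ := (h.inv₀ hl.ne').bddAbove_range
  have le_C (n) : u n ≤ C := hC ⟨n, rfl⟩
  have inv_le_D (n) : (u n)⁻¹ ≤ D := hD ⟨n, rfl⟩
  have hD0 : 0 < D := (inv_pos.2 (hu 0)).trans_le (inv_le_D 0)
  exact ⟨D⁻¹, C, inv_pos.2 hD0, (hu 0).trans_le (le_C 0), fun n =>
    ⟨inv_le_of_inv_le₀ (hu n) (inv_le_D n), le_C n⟩⟩

theorem exists_elephantA_sq_bounds (hp : 0 < p) : ∃ c C : ℝ, 0 < c ∧ 0 < C ∧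
    ∀ k : ℕ, 1 ≤ k → c * (k : ℝ) ^ (2 - 4 * p) ≤ elephantA p k ^ 2 ∧
      elephantA p k ^ 2 ≤ C * (k : ℝ) ^ (2 - 4 * p) := by
  have hΓ := Real.Gamma_pos_of_pos (show (0 : ℝ) < 2 * p by linarith)
  obtain ⟨c, C, hc, hC, bounds⟩ := exists_pos_bounds_of_tendsto
    (fun n => pow_pos (mul_pos (elephantA_pos hp n.succ_pos)
      (Real.rpow_pos_of_pos (by positivity) (2 * p - 1))) 2) (pow_pos hΓ 2)
    (((tendsto_add_atTop_iff_nat 1).2 (tendsto_elephantA_mul_rpow hp)).pow 2)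
  refine ⟨c, C, hc, hC, fun k hk => ?_⟩
  obtain ⟨m, rfl⟩ := Nat.exists_eq_add_of_le' hk
  have hm : (0 : ℝ) ≤ ((m + 1 : ℕ) : ℝ) := by positivity
  have sq_rpow : (((m + 1 : ℕ) : ℝ) ^ (2 * p - 1)) ^ 2 = (((m + 1 : ℕ) : ℝ) ^ (2 - 4 * p))⁻¹ := by
    rw [← Real.rpow_natCast, ← Real.rpow_mul hm, ← Real.rpow_neg hm]
    congr 1
    push_cast
    ring
  have hpow : 0 < ((m + 1 : ℕ) : ℝ) ^ (2 - 4 * p) := Real.rpow_pos_of_pos (by positivity) _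
  have := bounds m
  rwa [mul_pow, sq_rpow, ← div_eq_mul_inv, le_div_iff₀ hpow, div_le_iff₀ hpow] at this

-- With `x = 2 * p - 1`, the increment `(k + 1) * a (k + 1) ^ 2 - k * a k ^ 2` is
-- `(1 - 2 * x - x ^ 2 / k) * a (k + 1) ^ 2`, and `1 - 2 * x ≤ 3`.
theorem mul_elephantA_sq_le (hp : 0 < p) (n : ℕ) : n * elephantA p n ^ 2 ≤ 3 * elephantV p n := by
  induction n with
  | zero => simp [elephantV]
  | succ n ih =>
    rw [elephantV_succ]
    rcases n.eq_zero_or_pos with rfl | hn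
    · simp [elephantA_one p hp, elephantV]
    have : (0 : ℝ) < n := Nat.cast_pos.2 hn
    have increment : ((n + 1 : ℕ) : ℝ) * elephantA p (n + 1) ^ 2 - n * elephantA p n ^ 2 =
        (1 - 2 * (2 * p - 1) - (2 * p - 1) ^ 2 / n) * elephantA p (n + 1) ^ 2 := by
      rw [← elephantA_succ_mul hp hn]
      push_cast
      field_simp
      ring
    have coefficient : 1 - 2 * (2 * p - 1) - (2 * p - 1) ^ 2 / n ≤ 3 := by
      have : 0 ≤ (2 * p - 1) ^ 2 / n := by positivity
      linarith
    linarith [mul_le_mul_of_nonneg_right coefficient (sq_nonneg (elephantA p (n + 1)))]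

-- With `x = 2 * p - 1`, the shift `x / 2` removes the term of order `1 / k` from the increment of
-- `(k - x / 2) * a k ^ 2`, which is `(1 - 2 * x + x ^ 3 / (2 * k ^ 2)) * a (k + 1) ^ 2`.
theorem mul_elephantV_le_sub_mul (hp : 0 < p) (hp' : p ≤ 3 / 4) {n : ℕ} (hn : 1 ≤ n) :
    (3 - 4 * p) / 2 * elephantV p n ≤ (n - (2 * p - 1) / 2) * elephantA p n ^ 2 := by
  induction n, hn using Nat.le_induction with
  | base =>
    rw [elephantV_one hp, elephantA_one p hp]
    norm_num
    linarith
  | succ n hn ih =>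
    have hn1 : (1 : ℝ) ≤ n := Nat.one_le_cast.2 hn
    have increment : (((n + 1 : ℕ) : ℝ) - (2 * p - 1) / 2) * elephantA p (n + 1) ^ 2 -
        (n - (2 * p - 1) / 2) * elephantA p n ^ 2 =
        (1 - 2 * (2 * p - 1) + (2 * p - 1) ^ 3 / (2 * n ^ 2)) * elephantA p (n + 1) ^ 2 := by
      rw [← elephantA_succ_mul hp hn]
      push_cast
      field_simp
      ring
    have coefficient : (3 - 4 * p) / 2 ≤
        1 - 2 * (2 * p - 1) + (2 * p - 1) ^ 3 / (2 * n ^ 2) := by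
      have : -(3 - 4 * p) / 2 ≤ (2 * p - 1) ^ 3 / (2 * n ^ 2) := by
        rw [le_div_iff₀ (by positivity)]
        have cube : -(3 - 4 * p) ≤ (2 * p - 1) ^ 3 := by
          nlinarith [sq_nonneg (2 * p - 1), mul_nonneg hp.le (sq_nonneg (2 * p - 1))]
        have hp0 : 0 ≤ 3 - 4 * p := by linarith
        nlinarith [mul_nonneg hp0 (show 0 ≤ (n : ℝ) ^ 2 - 1 by nlinarith)]
      linarith
    rw [elephantV_succ]
    linarith [mul_le_mul_of_nonneg_right coefficient (sq_nonneg (elephantA p (n + 1)))]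

theorem mul_elephantV_le (hp : 0 < p) (hp' : p ≤ 3 / 4) {n : ℕ} (hn : 1 ≤ n) :
    (3 - 4 * p) * elephantV p n ≤ 3 * (n * elephantA p n ^ 2) := by
  have hn1 : (1 : ℝ) ≤ n := Nat.one_le_cast.2 hn
  have shift : (n - (2 * p - 1) / 2) * elephantA p n ^ 2 ≤ 3 / 2 * n * elephantA p n ^ 2 := by
    gcongr
    linarith
  linarith [mul_elephantV_le_sub_mul hp hp' hn]

theorem exists_mul_rpow_le_elephantV (hp : 0 < p) :
    ∃ c : ℝ, 0 < c ∧ ∀ n : ℕ, 1 ≤ n → c * (n : ℝ) ^ (3 - 4 * p) ≤ elephantV p n := by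
  obtain ⟨c, _, hc, _, bounds⟩ := exists_elephantA_sq_bounds hp
  refine ⟨c / 3, by positivity, fun n hn => ?_⟩
  have hn0 : (0 : ℝ) < n := Nat.cast_pos.2 hn
  calc c / 3 * (n : ℝ) ^ (3 - 4 * p) = n * (c * (n : ℝ) ^ (2 - 4 * p)) / 3 := by
        rw [show 3 - 4 * p = 2 - 4 * p + 1 by ring, Real.rpow_add_one hn0.ne']
        ring
    _ ≤ n * elephantA p n ^ 2 / 3 := by gcongr; exact (bounds n hn).1
    _ ≤ elephantV p n := by linarith [mul_elephantA_sq_le hp n]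

-- For `s = 3 - 4 * p` this is `mul_elephantV_le`; larger exponents reduce to the memory parameter
-- `(3 - s) / 4`, whose normalizing sequence dominates up to a constant.
theorem exists_elephantV_le_mul_rpow {s : ℝ} (hp : 0 < p) (hs : 0 < s) (hs' : s < 3)
    (hps : 3 - 4 * p ≤ s) :
    ∃ C : ℝ, 0 < C ∧ ∀ n : ℕ, 1 ≤ n → elephantV p n ≤ C * (n : ℝ) ^ s := by
  obtain ⟨_, C, _, hC, upper⟩ := exists_elephantA_sq_bounds hp
  obtain ⟨c', C', hc', hC', bounds⟩ :=
    exists_elephantA_sq_bounds (p := (3 - s) / 4) (by linarith)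
  have exponent : 2 - 4 * ((3 - s) / 4) = s - 1 := by ring
  rw [exponent] at bounds
  have domination (k : ℕ) (hk : 1 ≤ k) :
      elephantA p k ^ 2 ≤ C / c' * elephantA ((3 - s) / 4) k ^ 2 := by
    have hk1 : (1 : ℝ) ≤ k := Nat.one_le_cast.2 hk
    calc elephantA p k ^ 2 ≤ C * (k : ℝ) ^ (2 - 4 * p) := (upper k hk).2
      _ ≤ C * (k : ℝ) ^ (s - 1) := by
          gcongr C * ?_
          exact Real.rpow_le_rpow_of_exponent_le hk1 (by linarith)
      _ = C / c' * (c' * (k : ℝ) ^ (s - 1)) := by field_simp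
      _ ≤ C / c' * elephantA ((3 - s) / 4) k ^ 2 := by gcongr; exact (bounds k hk).1
  refine ⟨C / c' * (3 / s * C'), by positivity, fun n hn => ?_⟩
  have hn0 : (0 : ℝ) < n := Nat.cast_pos.2 hn
  have regular := mul_elephantV_le (p := (3 - s) / 4) (by linarith) (by linarith) hn
  calc elephantV p n ≤ C / c' * elephantV ((3 - s) / 4) n := by
        rw [elephantV, elephantV, Finset.mul_sum]
        exact Finset.sum_le_sum fun k hk => domination k (Finset.mem_Icc.1 hk).1
    _ ≤ C / c' * (3 / s * (n * elephantA ((3 - s) / 4) n ^ 2)) := by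
        gcongr
        rw [div_mul_eq_mul_div, le_div_iff₀ hs]
        linarith
    _ ≤ C / c' * (3 / s * (n * (C' * (n : ℝ) ^ (s - 1)))) := by
        gcongr
        exact (bounds n hn).2
    _ = C / c' * (3 / s * C') * (n : ℝ) ^ s := by
        rw [Real.rpow_sub_one hn0.ne']
        field_simp

theorem elephantA_succ_le (hp : 0 < p) {k : ℕ} (hk : 1 ≤ k) :
    elephantA p (k + 1) ≤ (1 + 1 / (2 * p)) * elephantA p k := by
  have hk1 : (1 : ℝ) ≤ k := Nat.one_le_cast.2 hk
  have one_le : 1 ≤ (1 + 1 / (2 * p)) * (1 + (2 * p - 1) / k) := by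
    have product : (1 + 1 / (2 * p)) * (1 + (2 * p - 1) / k) =
        (2 * p * k + (k - 1) + 4 * p ^ 2) / (2 * p * k) := by
      field_simp
      ring
    rw [product, one_le_div (by positivity)]
    nlinarith [sq_nonneg p]
  rw [← elephantA_succ_mul hp hk, mul_left_comm]
  exact le_mul_of_one_le_right (elephantA_pos hp k.succ_pos).le one_le

end Asymptotics

section Sums

variable {p : ℝ}

theorem elephantDrift_eq {k : ℕ} (hk : 1 ≤ k) :
    elephantDrift p k = elephantV p k / (elephantA p k * k) ^ 2 :=
  if_neg (by omega)

theorem elephantA_succ_sq_mul_drift_le (hp : 0 < p) {k : ℕ} (hk : 1 ≤ k) :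
    elephantA p (k + 1) ^ 2 * elephantDrift p k ≤
      (1 + 1 / (2 * p)) ^ 2 * (elephantV p k / (k : ℝ) ^ 2) := by
  have ha := elephantA_pos hp hk
  have ha' := elephantA_pos hp k.succ_pos
  have hV := one_pos.trans_le (one_le_elephantV hp hk)
  have : (0 : ℝ) < k := Nat.cast_pos.2 hk
  rw [elephantDrift_eq hk]
  calc elephantA p (k + 1) ^ 2 * (elephantV p k / (elephantA p k * k) ^ 2) ≤
        ((1 + 1 / (2 * p)) * elephantA p k) ^ 2 *
          (elephantV p k / (elephantA p k * k) ^ 2) := by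
        gcongr
        exact elephantA_succ_le hp hk
    _ = (1 + 1 / (2 * p)) ^ 2 * (elephantV p k / (k : ℝ) ^ 2) := by field_simp

theorem exists_sum_elephantA_sq_mul_drift_le (hp : 0 < p) : ∃ C : ℝ, 0 < C ∧ ∀ (n : ℕ) (L : ℝ),
    1 ≤ L → (∀ k, 1 ≤ k → k ≤ n → elephantV p k ≤ L * √(k : ℝ)) →
    ∑ k ∈ Finset.range n, elephantA p (k + 1) ^ 2 * elephantDrift p k ≤ C * L := by
  set r := 1 + 1 / (2 * p)
  have summable : Summable fun k : ℕ => (k : ℝ) ^ (-(3 / 2) : ℝ) :=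
    Real.summable_nat_rpow.2 (by norm_num)
  have nonneg (k : ℕ) : 0 ≤ (k : ℝ) ^ (-(3 / 2) : ℝ) := by positivity
  refine ⟨1 + r ^ 2 * ∑' k : ℕ, (k : ℝ) ^ (-(3 / 2) : ℝ), by positivity, fun n L hL growth => ?_⟩
  have term_le (k : ℕ) (hk : k < n) : elephantA p (k + 1) ^ 2 * elephantDrift p k ≤
      (if k = 0 then L else 0) + r ^ 2 * L * (k : ℝ) ^ (-(3 / 2) : ℝ) := by
    rcases k.eq_zero_or_pos with rfl | hk0
    · simpa [elephantDrift, elephantA_one p hp] using hL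
    have hkr : (0 : ℝ) < k := Nat.cast_pos.2 hk0
    have power : √(k : ℝ) / (k : ℝ) ^ 2 = (k : ℝ) ^ (-(3 / 2) : ℝ) := by
      rw [Real.sqrt_eq_rpow, ← Real.rpow_natCast, ← Real.rpow_sub hkr]
      norm_num
    rw [if_neg hk0.ne', zero_add, ← power, mul_assoc, ← mul_div_assoc]
    refine (elephantA_succ_sq_mul_drift_le hp hk0).trans ?_
    gcongr
    exact growth k hk0 hk.le
  calc _ ≤ ∑ k ∈ Finset.range n,
        ((if k = 0 then L else 0) + r ^ 2 * L * (k : ℝ) ^ (-(3 / 2) : ℝ)) :=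
        Finset.sum_le_sum fun k hk => term_le k (Finset.mem_range.1 hk)
    _ ≤ L + r ^ 2 * L * ∑' k : ℕ, (k : ℝ) ^ (-(3 / 2) : ℝ) := by
        rw [Finset.sum_add_distrib, ← Finset.mul_sum, Finset.sum_ite_eq']
        gcongr
        · split_ifs <;> linarith
        · exact summable.sum_le_tsum _ fun k _ => nonneg k
    _ = _ := by ring

theorem elephantA_sq_le_of_elephantV_le (hp : 0 < p) {k : ℕ} (hk : 1 ≤ k) {L : ℝ}
    (hL : elephantV p k ≤ L * √(k : ℝ)) : elephantA p k ^ 2 ≤ 3 * L := by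
  have hk1 : (1 : ℝ) ≤ k := Nat.one_le_cast.2 hk
  have hs : 1 ≤ √(k : ℝ) := Real.one_le_sqrt.2 hk1
  have sqrt_le : √(k : ℝ) ≤ k := by nlinarith [Real.sq_sqrt (zero_le_one.trans hk1)]
  have hL0 : 0 ≤ L := by nlinarith [one_le_elephantV hp hk]
  have : k * elephantA p k ^ 2 ≤ k * (3 * L) := by
    nlinarith [mul_elephantA_sq_le hp k, mul_le_mul_of_nonneg_left sqrt_le hL0]
  exact le_of_mul_le_mul_left this (by linarith)

theorem sum_elephantA_pow_four_le (hp : 0 < p) {n : ℕ} {L : ℝ}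
    (growth : ∀ k, 1 ≤ k → k ≤ n → elephantV p k ≤ L * √(k : ℝ)) :
    ∑ k ∈ Finset.range n, elephantA p (k + 1) ^ 4 ≤ 3 * L * elephantV p n := by
  rw [elephantV_eq_sqSum, sqSum, Finset.mul_sum]
  refine Finset.sum_le_sum fun k hk => ?_
  have := elephantA_sq_le_of_elephantV_le hp k.succ_pos
    (growth (k + 1) k.succ_pos (Finset.mem_range.1 hk))
  nlinarith [sq_nonneg (elephantA p (k + 1))]

theorem elephantA_succ_mul_sqrt_drift_le (hp : 0 < p) {k n : ℕ} (hkn : k < n) :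
    elephantA p (k + 1) * √(elephantDrift p k) ≤
      √(elephantV p n) * (2 * (1 + 1 / (2 * p)) / (k + 1)) := by
  set r := 1 + 1 / (2 * p) with hr
  have hr1 : 1 ≤ r := by rw [hr]; linarith [show 0 < 1 / (2 * p) by positivity]
  have hs1 : 1 ≤ √(elephantV p n) := Real.one_le_sqrt.2 (one_le_elephantV hp (by omega))
  rcases k.eq_zero_or_pos with rfl | hk0
  · simp only [elephantDrift, elephantA_one p hp, zero_add, if_true, Nat.cast_zero, Real.sqrt_one,
      div_one, mul_one]
    nlinarith
  have hkr : (1 : ℝ) ≤ k := Nat.one_le_cast.2 hk0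
  have ha := elephantA_pos hp hk0
  rw [elephantDrift_eq hk0, Real.sqrt_div' _ (by positivity), Real.sqrt_sq (by positivity)]
  calc _ ≤ r * elephantA p k * (√(elephantV p n) / (elephantA p k * k)) := by
        gcongr
        · exact elephantA_succ_le hp hk0
        · exact elephantV_mono p hkn.le
    _ = √(elephantV p n) * (r / k) := by field_simp
    _ ≤ √(elephantV p n) * (2 * r / (k + 1)) := by
        gcongr ?_ * ?_
        rw [div_le_div_iff₀ (by linarith) (by linarith)]
        nlinarith

theorem elephantDrift_le {D : ℝ} (hp : 0 < p) (hD : 1 ≤ D) {k : ℕ}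
    (regular : 1 ≤ k → elephantV p k ≤ D * (k * elephantA p k ^ 2)) :
    elephantDrift p k ≤ 2 * D / (k + 1) := by
  rcases k.eq_zero_or_pos with rfl | hk0
  · simp only [elephantDrift, if_true, Nat.cast_zero, zero_add, div_one]
    linarith
  have hkr : (1 : ℝ) ≤ k := Nat.one_le_cast.2 hk0
  have ha := elephantA_pos hp hk0
  calc elephantDrift p k ≤ D * (k * elephantA p k ^ 2) / (elephantA p k * k) ^ 2 := by
        rw [elephantDrift_eq hk0]
        gcongr
        exact regular hk0
    _ = D / k := by field_simp
    _ ≤ 2 * D / (k + 1) := by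
        rw [div_le_div_iff₀ (by linarith) (by linarith)]
        nlinarith

theorem exists_halving_index (hp : 0 < p) {n : ℕ} (hn : 1 ≤ n) :
    ∃ K < n, elephantV p K ≤ elephantV p n / 2 ∧ elephantV p n < 2 * elephantV p (K + 1) := by
  have hV := one_pos.trans_le (one_le_elephantV hp hn)
  have exists_gt : ∃ k, elephantV p n < 2 * elephantV p k := ⟨n, by linarith⟩
  classical
  obtain ⟨K, hK⟩ : ∃ K, Nat.find exists_gt = K + 1 := Nat.exists_eq_add_one.2 <|
    (Nat.find_pos exists_gt).2 (by simpa [elephantV] using hV.le)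
  refine ⟨K, ?_, ?_, hK ▸ Nat.find_spec exists_gt⟩
  · have := Nat.find_min' exists_gt (show elephantV p n < 2 * elephantV p n by linarith)
    omega
  · have := Nat.find_min exists_gt (show K < Nat.find exists_gt by omega)
    linarith

end Sums

section Rates

variable {p : ℝ}

theorem mul_elephantA_succ_le_sqrt (hp : 0 < p) {k n : ℕ} (hkn : k < n) {E : ℝ} (hE : 0 < E)
    (hk : 1 / ((k : ℝ) + 1) ≤ E ^ 2) : 1 / (2 * E) * elephantA p (k + 1) ≤ √(elephantV p n) := by
  have hV : 0 ≤ elephantV p n := zero_le_one.trans (one_le_elephantV hp (by omega))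
  have one_le : 1 ≤ E ^ 2 * (k + 1) := (div_le_iff₀ (by positivity)).1 hk
  have sq_le : elephantA p (k + 1) ^ 2 ≤ 3 * elephantV p n * E ^ 2 := by
    have := (mul_elephantA_sq_le hp (k + 1)).trans
      (mul_le_mul_of_nonneg_left (elephantV_mono p hkn) zero_le_three)
    push_cast at this
    nlinarith [mul_le_mul_of_nonneg_left one_le (sq_nonneg (elephantA p (k + 1))),
      mul_le_mul_of_nonneg_left this (sq_nonneg E)]
  refine Real.le_sqrt_of_sq_le ?_
  calc (1 / (2 * E) * elephantA p (k + 1)) ^ 2 = elephantA p (k + 1) ^ 2 / (4 * E ^ 2) := by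
        field_simp
        ring
    _ ≤ elephantV p n := by
        rw [div_le_iff₀ (by positivity)]
        linarith [mul_nonneg hV (sq_nonneg E)]

theorem exists_isElephantKolmogorovBound_of_le_mul_sqrt (hp : 0 < p) : ∃ C : ℝ, 0 < C ∧
    ∀ (n K : ℕ) (L E : ℝ) (_ : K < n) (_ : elephantV p K ≤ elephantV p n / 2) (_ : 0 < E)
      (_ : ∀ k, 1 ≤ k → k ≤ n → elephantV p k ≤ L * √(k : ℝ))
      (_ : ∀ k, K ≤ k → 1 / ((k : ℝ) + 1) ≤ E ^ 2)
      (_ : ∀ k, K ≤ k → k < n → elephantDrift p k ≤ 2 * E ^ 2),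
      IsElephantKolmogorovBound p n (C * (L / elephantV p n + E)) := by
  obtain ⟨C₀, hC₀, bound⟩ := exists_isElephantKolmogorovBound
  obtain ⟨C₁, hC₁, drift_sum⟩ := exists_sum_elephantA_sq_mul_drift_le hp
  set r := 1 + 1 / (2 * p) with hr
  have hr1 : 1 ≤ r := by rw [hr]; linarith [show 0 < 1 / (2 * p) by positivity]
  refine ⟨C₀ * (C₁ + 3 + r + 2), by positivity, ?_⟩
  intro n K L E hKn hhalf hE growth inv_le drift_le
  have hn : 1 ≤ n := by omega
  have hV := one_pos.trans_le (one_le_elephantV hp hn)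
  have hL : 1 ≤ L := by simpa [elephantV_one hp] using growth 1 le_rfl hn
  refine (bound p hp n K hn hKn.le hhalf (1 / (2 * E)) (2 * r * E ^ 2) (by positivity)
    (by positivity) (fun k hk hkn => mul_elephantA_succ_le_sqrt hp hkn hE (inv_le k hk))
    (fun k hk hkn => ?_) fun k hk hkn => ?_).mono ?_
  · exact (drift_le k hk hkn).trans (by nlinarith [sq_nonneg E])
  · refine (elephantA_succ_mul_sqrt_drift_le hp hkn).trans ?_
    rw [← mul_one_div]
    gcongr
    exact inv_le k hk
  · calc _ ≤ C₀ * (C₁ * L / elephantV p n + 3 * L * elephantV p n / elephantV p n ^ 2 +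
          2 * r * E ^ 2 * (1 / (2 * E)) + 1 / (1 / (2 * E))) := by
          gcongr
          · exact drift_sum n L hL growth
          · exact sum_elephantA_pow_four_le hp growth
      _ = C₀ * ((C₁ + 3) * (L / elephantV p n) + (r + 2) * E) := by field_simp; ring
      _ ≤ C₀ * (C₁ + 3 + r + 2) * (L / elephantV p n + E) := by
          have : 0 < L / elephantV p n := by positivity
          rw [mul_assoc]
          gcongr
          nlinarith

theorem exists_isElephantKolmogorovBound_of_growth (hp : 0 < p) : ∃ C : ℝ, 0 < C ∧
    ∀ (n : ℕ) (L D m : ℝ) (_ : 1 ≤ n) (_ : 0 < m)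
      (_ : ∀ k, 1 ≤ k → k ≤ n → elephantV p k ≤ L * √(k : ℝ))
      (_ : ∀ k, 1 ≤ k → k ≤ n → elephantV p k ≤ D * (k * elephantA p k ^ 2))
      (_ : ∀ k, 1 ≤ k → elephantV p n ≤ 2 * elephantV p k → m ≤ k),
      IsElephantKolmogorovBound p n (C * (L / elephantV p n + √(D / m))) := by
  obtain ⟨C, hC, bound⟩ := exists_isElephantKolmogorovBound_of_le_mul_sqrt hp
  refine ⟨C, hC, fun n L D m hn hm growth regular le_of_half_le => ?_⟩
  obtain ⟨K, hKn, hhalf, hKsucc⟩ := exists_halving_index hp hn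
  have hD : 1 ≤ D := by simpa [elephantV_one hp, elephantA_one p hp] using regular 1 le_rfl hn
  have hE2 : √(D / m) ^ 2 = D / m := Real.sq_sqrt (by positivity)
  have div_le (k : ℕ) (hk : K ≤ k) : D / (k + 1) ≤ √(D / m) ^ 2 := by
    have := le_of_half_le (K + 1) K.succ_pos hKsucc.le
    rw [hE2]
    gcongr
    refine this.trans ?_
    exact_mod_cast Nat.succ_le_succ hk
  refine bound n K L √(D / m) hKn hhalf (Real.sqrt_pos.2 (by positivity)) growth
    (fun k hk => le_trans (by gcongr) (div_le k hk)) fun k hk hkn => ?_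
  calc elephantDrift p k ≤ 2 * (D / (k + 1)) := by
        rw [← mul_div_assoc]
        exact elephantDrift_le hp hD (regular k · hkn.le)
    _ ≤ 2 * √(D / m) ^ 2 := by gcongr; exact div_le k hk

theorem exists_div_le_of_elephantV_le_two_mul (hp : 0 < p) (hp' : p < 3 / 4) :
    ∃ R : ℝ, 0 < R ∧ ∀ n k : ℕ, 1 ≤ n → 1 ≤ k → elephantV p n ≤ 2 * elephantV p k → n / R ≤ k := by
  obtain ⟨c, hc, lower⟩ := exists_mul_rpow_le_elephantV hp
  obtain ⟨C, hC, upper⟩ :=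
    exists_elephantV_le_mul_rpow hp (s := 3 - 4 * p) (by linarith) (by linarith) le_rfl
  have hγ : 0 < 3 - 4 * p := by linarith
  refine ⟨(2 * C / c) ^ (3 - 4 * p)⁻¹, by positivity, fun n k hn hk half_le => ?_⟩
  rw [div_le_iff₀ (by positivity), ← Real.rpow_le_rpow_iff (by positivity) (by positivity) hγ,
    Real.mul_rpow (by positivity) (by positivity), Real.rpow_inv_rpow (by positivity) hγ.ne',
    mul_div_assoc', le_div_iff₀ hc]
  linarith [lower n hn, upper k hk]

theorem exists_isElephantKolmogorovBound_of_lt (hp : 0 < p) (hp' : p < 3 / 4) :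
    ∃ C : ℝ, 0 < C ∧ ∀ (n : ℕ) (L : ℝ) (_ : 1 ≤ n)
      (_ : ∀ k, 1 ≤ k → k ≤ n → elephantV p k ≤ L * √(k : ℝ)),
      IsElephantKolmogorovBound p n (C * (L / elephantV p n + 1 / √(n : ℝ))) := by
  obtain ⟨C, hC, bound⟩ := exists_isElephantKolmogorovBound_of_growth hp
  obtain ⟨R, hR, div_le⟩ := exists_div_le_of_elephantV_le_two_mul hp hp'
  have hγ : 0 < 3 - 4 * p := by linarith
  set s := √(3 / (3 - 4 * p) * R)
  refine ⟨C * (1 + s), by positivity, fun n L hn growth => ?_⟩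
  have : (0 : ℝ) < n := Nat.cast_pos.2 hn
  have hV := one_pos.trans_le (one_le_elephantV hp hn)
  have hL : 1 ≤ L := by simpa [elephantV_one hp] using growth 1 le_rfl hn
  have regular (k : ℕ) (hk : 1 ≤ k) :
      elephantV p k ≤ 3 / (3 - 4 * p) * (k * elephantA p k ^ 2) := by
    rw [div_mul_eq_mul_div, le_div_iff₀ hγ, mul_comm]
    exact mul_elephantV_le hp hp'.le hk
  refine (bound n L _ (n / R) hn (by positivity) growth (fun k hk _ => regular k hk)
    (fun k hk => div_le n k hn hk)).mono ?_
  have sqrt_eq : √(3 / (3 - 4 * p) / (n / R)) = s * (1 / √(n : ℝ)) := by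
    rw [div_div_eq_mul_div, Real.sqrt_div (by positivity), mul_one_div]
  have hLV : 0 < L / elephantV p n := by positivity
  have hsn : 0 < 1 / √(n : ℝ) := by positivity
  rw [sqrt_eq, mul_assoc]
  gcongr
  nlinarith [Real.sqrt_nonneg (3 / (3 - 4 * p) * R)]

theorem exists_isElephantKolmogorovBound_inv_sqrt (hp : 0 < p) (hp' : p ≤ 5 / 8) :
    ∃ C : ℝ, 0 < C ∧ ∀ n : ℕ, 1 ≤ n → IsElephantKolmogorovBound p n (C * (1 / √(n : ℝ))) := by
  obtain ⟨C₀, hC₀, bound⟩ := exists_isElephantKolmogorovBound_of_lt hp (by linarith)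
  obtain ⟨c, hc, lower⟩ := exists_mul_rpow_le_elephantV hp
  obtain ⟨C, hC, upper⟩ :=
    exists_elephantV_le_mul_rpow hp (s := 3 - 4 * p) (by linarith) (by linarith) le_rfl
  refine ⟨C₀ * (C / c + 1), by positivity, fun n hn => ?_⟩
  have rpow_eq (k : ℕ) (hk : 1 ≤ k) :
      (k : ℝ) ^ (3 - 4 * p) = (k : ℝ) ^ (3 - 4 * p - 1 / 2) * √(k : ℝ) := by
    rw [Real.sqrt_eq_rpow, ← Real.rpow_add (Nat.cast_pos.2 hk), sub_add_cancel]
  refine (bound n (C * (n : ℝ) ^ (3 - 4 * p - 1 / 2)) hn fun k hk hkn => ?_).mono ?_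
  · refine (upper k hk).trans ?_
    rw [rpow_eq k hk, ← mul_assoc]
    gcongr
    linarith
  · have : (0 : ℝ) < n := Nat.cast_pos.2 hn
    have lower_n := lower n hn
    rw [rpow_eq n hn] at lower_n
    calc _ ≤ C₀ * (C * (n : ℝ) ^ (3 - 4 * p - 1 / 2) /
          (c * ((n : ℝ) ^ (3 - 4 * p - 1 / 2) * √(n : ℝ))) + 1 / √(n : ℝ)) := by gcongr
      _ = C₀ * (C / c + 1) * (1 / √(n : ℝ)) := by field_simp

theorem exists_elephantV_le_mul_sqrt (hp : 5 / 8 ≤ p) :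
    ∃ C : ℝ, 0 < C ∧ ∀ n : ℕ, 1 ≤ n → elephantV p n ≤ C * √(n : ℝ) := by
  simpa only [Real.sqrt_eq_rpow] using
    exists_elephantV_le_mul_rpow (p := p) (s := 1 / 2) (by linarith) (by norm_num) (by norm_num)
      (by linarith)

theorem exists_isElephantKolmogorovBound_inv_elephantV_of_lt (hp : 5 / 8 ≤ p) (hp' : p < 3 / 4) :
    ∃ C : ℝ, 0 < C ∧ ∀ n : ℕ, 1 ≤ n →
      IsElephantKolmogorovBound p n (C * (1 / elephantV p n)) := by
  have hp0 : 0 < p := by linarith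
  obtain ⟨C₀, hC₀, bound⟩ := exists_isElephantKolmogorovBound_of_lt hp0 hp'
  obtain ⟨C, hC, upper⟩ := exists_elephantV_le_mul_sqrt hp
  refine ⟨C₀ * (C + C), by positivity, fun n hn => ?_⟩
  have hV := one_pos.trans_le (one_le_elephantV hp0 hn)
  refine (bound n C hn fun k hk _ => upper k hk).mono ?_
  have inv_sqrt_le : 1 / √(n : ℝ) ≤ C / elephantV p n := by
    rw [div_le_div_iff₀ (Real.sqrt_pos.2 (Nat.cast_pos.2 hn)) hV, one_mul]
    exact upper n hn
  calc C₀ * (C / elephantV p n + 1 / √(n : ℝ)) ≤ C₀ * (C / elephantV p n + C / elephantV p n) := by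
        gcongr
    _ = C₀ * (C + C) * (1 / elephantV p n) := by ring

theorem exists_elephantV_three_quarters_cube_le :
    ∃ C : ℝ, 0 < C ∧ ∀ n : ℕ, 1 ≤ n → elephantV (3 / 4) n ^ 3 ≤ C * n := by
  obtain ⟨C, hC, upper⟩ := exists_elephantV_le_mul_rpow (p := 3 / 4) (s := 1 / 3)
    (by norm_num) (by norm_num) (by norm_num) (by norm_num)
  refine ⟨C ^ 3, by positivity, fun n hn => ?_⟩
  have hV := one_pos.trans_le (one_le_elephantV (p := 3 / 4) (by norm_num) hn)
  have cube : ((n : ℝ) ^ (1 / 3 : ℝ)) ^ 3 = n := by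
    rw [← Real.rpow_natCast, ← Real.rpow_mul n.cast_nonneg]
    norm_num
  calc elephantV (3 / 4) n ^ 3 ≤ (C * (n : ℝ) ^ (1 / 3 : ℝ)) ^ 3 := by gcongr; exact upper n hn
    _ = C ^ 3 * n := by rw [mul_pow, cube]

-- As `elephantV (3 / 4)` grows more slowly than any power, it reaches half of its value at `n` only
-- at indices of order at least `elephantV (3 / 4) n ^ 3`.
theorem exists_isElephantKolmogorovBound_three_quarters :
    ∃ C : ℝ, 0 < C ∧ ∀ n : ℕ, 1 ≤ n →
      IsElephantKolmogorovBound (3 / 4) n (C * (1 / elephantV (3 / 4) n)) := by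
  have hp : (0 : ℝ) < 3 / 4 := by norm_num
  obtain ⟨C₀, hC₀, bound⟩ := exists_isElephantKolmogorovBound_of_growth hp
  obtain ⟨L, hL, upper⟩ := exists_elephantV_le_mul_sqrt (p := 3 / 4) (by norm_num)
  obtain ⟨A, hA, cube_le⟩ := exists_elephantV_three_quarters_cube_le
  obtain ⟨c, _, hc, _, bounds⟩ := exists_elephantA_sq_bounds hp
  have le_mul_sq (k : ℕ) (hk : 1 ≤ k) : c ≤ k * elephantA (3 / 4) k ^ 2 := by
    have hk0 : (0 : ℝ) < k := Nat.cast_pos.2 hk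
    have := (bounds k hk).1
    rw [show (2 - 4 * (3 / 4) : ℝ) = -1 by norm_num, Real.rpow_neg_one, ← div_eq_mul_inv,
      div_le_iff₀' hk0] at this
    exact this
  set s := √(8 * A / c)
  refine ⟨C₀ * (L + s), by positivity, fun n hn => ?_⟩
  have hV := one_pos.trans_le (one_le_elephantV hp hn)
  refine (bound n L (elephantV (3 / 4) n / c) (elephantV (3 / 4) n ^ 3 / (8 * A)) hn
    (by positivity) (fun k hk _ => upper k hk) (fun k hk hkn => ?_) fun k hk half_le => ?_).mono ?_
  · rw [div_mul_eq_mul_div, le_div_iff₀ hc]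
    exact mul_le_mul (elephantV_mono _ hkn) (le_mul_sq k hk) hc.le hV.le
  · rw [div_le_iff₀ (by positivity)]
    calc elephantV (3 / 4) n ^ 3 ≤ (2 * elephantV (3 / 4) k) ^ 3 := by gcongr
      _ = 8 * elephantV (3 / 4) k ^ 3 := by ring
      _ ≤ 8 * (A * k) := by gcongr; exact cube_le k hk
      _ = k * (8 * A) := by ring
  · have sqrt_eq : √(elephantV (3 / 4) n / c / (elephantV (3 / 4) n ^ 3 / (8 * A))) =
        s / elephantV (3 / 4) n := by
      rw [show elephantV (3 / 4) n / c / (elephantV (3 / 4) n ^ 3 / (8 * A)) =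
        8 * A / c / elephantV (3 / 4) n ^ 2 by field_simp, Real.sqrt_div' _ (by positivity),
        Real.sqrt_sq hV.le]
    rw [sqrt_eq]
    exact le_of_eq (by ring)

theorem exists_isElephantKolmogorovBound_inv_elephantV (hp : 5 / 8 ≤ p) (hp' : p ≤ 3 / 4) :
    ∃ C : ℝ, 0 < C ∧ ∀ n : ℕ, 1 ≤ n →
      IsElephantKolmogorovBound p n (C * (1 / elephantV p n)) := by
  rcases hp'.eq_or_lt with rfl | hlt
  · exact exists_isElephantKolmogorovBound_three_quarters
  · exact exists_isElephantKolmogorovBound_inv_elephantV_of_lt hp hlt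

end Rates

end

theorem theorem3 (p q : ℝ) (hp : 0 < p) (hp' : p ≤ 3 / 4) (hq : 0 < q) (hq' : q ≤ 1) :
    ∃ C : ℝ, 0 < C ∧
      ∀ (Ω : Type*) [MeasurableSpace Ω] (μ : Measure Ω) [IsProbabilityMeasure μ]
        (X α : ℕ → Ω → ℝ) (β : ℕ → Ω → ℕ), IsElephantWalk μ p q X α β →
        ∀ n : ℕ, 1 ≤ n →
          kolmogorovDist μ (fun ω =>
              (elephantA p n * elephantPosition X n ω - (2 * q - 1)) / √(elephantV p n))
            ≤ C * (1 / √(n : ℝ) + 1 / elephantV p n) ∧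
          (p ≤ 5 / 8 →
            kolmogorovDist μ (fun ω =>
              (elephantA p n * elephantPosition X n ω - (2 * q - 1)) / √(elephantV p n))
            ≤ C * (1 / √(n : ℝ))) ∧
          (5 / 8 < p →
            kolmogorovDist μ (fun ω =>
              (elephantA p n * elephantPosition X n ω - (2 * q - 1)) / √(elephantV p n))
            ≤ C * (1 / elephantV p n)) := by
  have rate : ∃ C : ℝ, 0 < C ∧ ∀ n : ℕ, 1 ≤ n → IsElephantKolmogorovBound p n
      (C * if p ≤ 5 / 8 then 1 / √(n : ℝ) else 1 / elephantV p n) := by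
    split_ifs with h
    · exact exists_isElephantKolmogorovBound_inv_sqrt hp h
    · exact exists_isElephantKolmogorovBound_inv_elephantV (not_le.1 h).le hp'
  obtain ⟨C, hC, bound⟩ := rate
  refine ⟨C, hC, fun Ω _ μ _ X α β hX n hn => ?_⟩
  have dist_le := bound n hn Ω μ q X α β hX
  have hV : 0 < elephantV p n := one_pos.trans_le (one_le_elephantV hp hn)
  refine ⟨dist_le.trans ?_, fun h => ?_, fun h => ?_⟩
  · gcongr
    split_ifs
    · exact le_add_of_nonneg_right (by positivity)
    · exact le_add_of_nonneg_left (by positivity)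
  · rwa [if_pos h] at dist_le
  · rwa [if_neg (not_le.2 h)] at dist_le
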